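/- Manifolds below are finite-dimensional smooth manifolds without boundary, Hausdorff and paracompact; a subset of a manifold carries the subspace smooth structure, and a tangent vector of such a subset is the velocity $\gamma'(0)$ of a smooth curve $\gamma$ in it. Let $P$ be a manifold and $X\subseteq Y\subseteq P$. A *smoothly local deflation* of $X$ in $Y$ consists of an open neighbourhood $V$ of $X$ in $Y$, a smooth retraction $\tau\colon V\to X$, and a smooth map $H\colon\mathbb R\times V\to V$, $(t,v)\mapsto H_t(v)$, such that $\tau H_t=\tau$, $H_sH_t=H_{st}$, $H_1=\mathrm{id}$ and $H_0=\tau$. With $\iota\colon X\to V$ the inclusion, let $\iota^*\ker T\tau$ be the space of tangent vectors of $V$ at points of $X$ that are annihilated by $T\tau$. The *kinematic map* $\psi\colon V\to\iota^*\ker T\tau$ sends $v$ to the velocity of the curve $t\mapsto H_t(v)$ at $t=0$. The deflation is a *smoothly locally kinematic structure* on $X\subseteq Y$ if $\psi$ is a diffeomorphism. **Theorem.** Let $f\colon M\to N$ be a regular smooth map of manifolds, that is, a smooth map of constant rank. Put $K_f=\{(x,y)\in M\times M: f(x)=f(y)\}$, $\Delta(M)=\{(x,x):x\in M\}$ and $G_f=\{(x,f(x)):x\in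 M\}\subseteq M\times N$. Then there are smoothly locally kinematic structures on $\Delta(M)\subseteq K_f$, on $\Delta(M)\subseteq M\times M$ and on $G_f\subseteq M\times N$, with neighbourhoods $V_K$, $V_M$, $V_N$, with retractions $(x,y)\mapsto(x,x)$, $(x,y)\mapsto(x,x)$ and $(x,y)\mapsto(x,f(x))$ respectively, and with kinematic maps $\psi_K,\psi_M,\psi_N$, and there are diffeomorphisms $$\nu_K\colon\ker Tf\to V_K,\qquad \nu_M\colon TM\to V_M,\qquad \nu_N\colon f^*TN\to V_N$$ inverse to the kinematic maps, in the sense that $\psi_K(\nu_K(v))=(0,v)\in T_{(x,x)}(M\times M)$ for $v\in\ker T_xf$, $\psi_M(\nu_M(v))=(0,v)\in T_{(x,x)}(M\times M)$ for $v\in T_xM$, and $\psi_N(\nu_N(x,w))=(0,w)\in T_{(x,f(x))}(M\times N)$ for $w\in T_{f(x)}N$, such that the diagram $$\begin{array}{ccccc}\ker Tf&\hookrightarrow&TM&\xrightarrow{\;Tf\;}&f^*TN\\ {\scriptstyle\nu_K}\downarrow&&{\scriptstyle\nu_M}\downarrow&&{\scriptstyle\nu_N}\downarrow\\ K_f&\hookrightarrow&M\times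 M&\xrightarrow{\mathrm{id}\times f}&M\times N\end{array}$$ commutes. -/

import Mathlib

open Set
open scoped Manifold ContDiff

/-- `f` restricts to a diffeomorphism from the subspace `s` onto the subspace `t`: both `f : s → t`
and an inverse `g : t → s` are smooth.  Subsets carry the subspace smooth structure. -/
def IsDiffeoOn {E₁ : Type*} [NormedAddCommGroup E₁] [NormedSpace ℝ E₁]
    {H₁ : Type*} [TopologicalSpace H₁] (I₁ : ModelWithCorners ℝ E₁ H₁)
    {E₂ : Type*} [NormedAddCommGroup E₂] [NormedSpace ℝ E₂]
    {H₂ : Type*} [TopologicalSpace H₂] (I₂ : ModelWithCorners ℝ E₂ H₂)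
    {P : Type*} [TopologicalSpace P] [ChartedSpace H₁ P]
    {Q : Type*} [TopologicalSpace Q] [ChartedSpace H₂ Q]
    (f : P → Q) (s : Set P) (t : Set Q) : Prop :=
  MapsTo f s t ∧ ContMDiffOn I₁ I₂ ∞ f s ∧
    ∃ g : Q → P, MapsTo g t s ∧ ContMDiffOn I₂ I₁ ∞ g t ∧ InvOn g f s t

section LocalStructures

variable {E : Type*} [NormedAddCommGroup E] [NormedSpace ℝ E]
  {H : Type*} [TopologicalSpace H] (I : ModelWithCorners ℝ E H)
  {P : Type*} [TopologicalSpace P] [ChartedSpace H P]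

/-- The tangent vector `γ'(0)`, based at `γ 0`, represented by a curve `γ : ℝ → P`. -/
noncomputable def velocity (γ : ℝ → P) : TangentBundle I P :=
  ⟨γ 0, mfderiv 𝓘(ℝ, ℝ) I γ 0 (1 : ℝ)⟩

/-- A smoothly local base `X ⊆ V ⊆ Y` of `X` in `Y`, where `Y` is a subspace of the manifold `P`:
an open neighbourhood `V` of `X` in `Y` together with a smooth retraction `τ : V → X`
(the values of `τ` outside `V` play no role). -/
structure SmoothLocalBase (X Y : Set P) where
  V : Set P
  τ : P → P
  isOpen_in : ∃ U : Set P, IsOpen U ∧ V = Y ∩ U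
  subset : X ⊆ V
  smooth_τ : ContMDiffOn I I ∞ τ V
  mapsTo_τ : MapsTo τ V X
  τ_eq_self : ∀ x ∈ X, τ x = x

/-- A smoothly local deflation of `X` in `Y`: a smoothly local base with a smooth action
`H : ℝ × V → V` of the multiplicative monoid `ℝ` along the fibres of `τ`, with `H₀ = τ`. -/
structure SmoothLocalDeflation (X Y : Set P) extends SmoothLocalBase I X Y where
  H : ℝ → P → P
  mapsTo_H : ∀ t, MapsTo (H t) V V
  smooth_H : ContMDiffOn (𝓘(ℝ, ℝ).prod I) I ∞ (fun p : ℝ × P => H p.1 p.2) (univ ×ˢ V)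
  τ_H : ∀ t, ∀ y ∈ V, τ (H t y) = τ y
  H_H : ∀ s t, ∀ y ∈ V, H s (H t y) = H (s * t) y
  H_one : ∀ y ∈ V, H 1 y = y
  H_zero : ∀ y ∈ V, H 0 y = τ y

variable {I}

/-- The restriction `ι^* ker Tτ` to `X` of `ker Tτ ⊆ TV`: the tangent vectors of `V` at points of
`X` that `Tτ` sends to zero.  Tangent vectors of `V` are represented by smooth curves `ℝ → V`. -/
def SmoothLocalBase.kerTangent {X Y : Set P} (B : SmoothLocalBase I X Y) :
    Set (TangentBundle I P) :=
  {w | ∃ γ : ℝ → P, ContMDiff 𝓘(ℝ, ℝ) I ∞ γ ∧ (∀ t, γ t ∈ B.V) ∧ γ 0 ∈ X ∧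
    velocity I γ = w ∧ velocity I (B.τ ∘ γ) = ⟨B.τ (γ 0), 0⟩}

/-- The kinematic map `ψ`, which sends `v ∈ V` to the tangent vector of `t ↦ H_t v` at `t = 0`. -/
noncomputable def SmoothLocalDeflation.kinematicMap {X Y : Set P} (S : SmoothLocalDeflation I X Y) (v : P) :
    TangentBundle I P :=
  velocity I (fun t => S.H t v)

/-- A deflation is kinematic if `ψ : V → ι^* ker Tτ` is a diffeomorphism. -/
def SmoothLocalDeflation.IsKinematic [IsManifold I 1 P] {X Y : Set P}
    (S : SmoothLocalDeflation I X Y) : Prop :=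
  IsDiffeoOn I I.tangent S.kinematicMap S.V S.kerTangent

end LocalStructures

section Maps

variable {E : Type*} [NormedAddCommGroup E] [NormedSpace ℝ E]
  {F : Type*} [NormedAddCommGroup F] [NormedSpace ℝ F]
  {M : Type*} [TopologicalSpace M] [ChartedSpace E M]
  {N : Type*} [TopologicalSpace N] [ChartedSpace F N]

/-- A regular smooth map: a smooth map of constant rank. -/
def IsRegularMap (E F : Type*) [NormedAddCommGroup E] [NormedSpace ℝ E]
    [NormedAddCommGroup F] [NormedSpace ℝ F]
    {M : Type*} [TopologicalSpace M] [ChartedSpace E M]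
    {N : Type*} [TopologicalSpace N] [ChartedSpace F N] (f : M → N) : Prop :=
  ContMDiff 𝓘(ℝ, E) 𝓘(ℝ, F) ∞ f ∧
    ∃ k : ℕ, ∀ x : M,
      Module.finrank ℝ (LinearMap.range (mfderiv 𝓘(ℝ, E) 𝓘(ℝ, F) f x).toLinearMap) = k

/-- `K_f = {(x, y) : f x = f y}`. -/
def levelPairs (f : M → N) : Set (M × M) := {p | f p.1 = f p.2}

/-- `G_f = {(x, f x)}`. -/
def graphSet (f : M → N) : Set (M × N) := {p | p.2 = f p.1}

/-- `ker Tf ⊆ TM`. -/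
def kerTangentMap (E F : Type*) [NormedAddCommGroup E] [NormedSpace ℝ E]
    [NormedAddCommGroup F] [NormedSpace ℝ F]
    {M : Type*} [TopologicalSpace M] [ChartedSpace E M]
    {N : Type*} [TopologicalSpace N] [ChartedSpace F N] (f : M → N) :
    Set (TangentBundle 𝓘(ℝ, E) M) :=
  {v | mfderiv 𝓘(ℝ, E) 𝓘(ℝ, F) f v.proj v.snd = 0}

/-- `f^*TN`, as the fibre product `M ×_N TN`. -/
def pullbackTangent (F : Type*) [NormedAddCommGroup F] [NormedSpace ℝ F]
    {M : Type*} {N : Type*} [TopologicalSpace N] [ChartedSpace F N] (f : M → N) :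
    Set (M × TangentBundle 𝓘(ℝ, F) N) :=
  {p | p.2.proj = f p.1}

/-- The vertical tangent vector `(0, w)` of `M × N` at `(x, y)`, for `w ∈ T_y N`. -/
noncomputable def verticalLift (x : M) (w : TangentBundle 𝓘(ℝ, F) N) :
    TangentBundle (𝓘(ℝ, E).prod 𝓘(ℝ, F)) (M × N) :=
  (equivTangentBundleProd 𝓘(ℝ, E) M 𝓘(ℝ, F) N).symm (⟨x, 0⟩, w)

end Maps

/-! Everything follows from fibrewise diffeomorphisms `νM` of `TM` onto a neighbourhood of the
diagonal and `νN` of `f^*TN` onto a neighbourhood of the graph, each with derivative the identity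
along the zero section, such that `f (νM x v) = νN x (Tf v)`. Conjugating scalar multiplication by
`ν` gives the deflation, and its kinematic map is inverse to `ν` because `t ↦ ν x (t • w)` has
velocity `w` at `0`. Moreover `f (νM x v) = f x = νN x 0` exactly when `Tf v = 0`, so `νM` restricts
to a diffeomorphism of `ker Tf` onto `K_f ∩ VM`.

Such a pair need not exist as exponential maps of metrics; it comes instead from the constant rank
theorem (`IsRegularMap.exists_isLinearizing`): there are charts `φ i`, `χ i` in which `f` is a
linear map `A i`. The chart difference `φ i y - φ i x`, read as a tangent vector at `x`, is averaged
over `i` with weights `ρ i x`. This gives a logarithm on `M`, and the charts `χ i` with the same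
weights give one along `f`. Linearity of `f` in each pair of charts makes `Tf` intertwine them
(`fibDeriv_tangentLog`). The vertical derivative along the graph is the identity, so the inverse
function theorem and a gluing argument invert both logarithms fibrewise near the zero section
(`exists_fibrewise_inverse`).

It remains to replace a neighbourhood of the zero section by the whole bundle without losing
compatibility with `Tf`. Radial contraction of `TM` by a norm would fail, since its factor would
depend on the `ker Tf` component. So `TM` is split by a projection `P` onto `ker Tf`. The complement
is contracted by a factor depending only on the norm of `Tf v` in `f^*TN`, the same factor as is
applied to `Tf v` there, and the kernel component is contracted by its own norm
(`fibreSplitting_kerProj`, `fibreScale`). Composing with the inverted logarithms yields the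
linearizations (`FibrewiseInverse.fibreLinearization`). -/

/-! ### Partitions of unity and neighbourhoods of a graph. -/

open Filter Topology Function in
/-- In a smooth manifold, a compact set inside an open set carries a smooth bump function. -/
theorem exists_contMDiff_pos_on_compact {E : Type*} [NormedAddCommGroup E] [NormedSpace ℝ E]
    [FiniteDimensional ℝ E] {M : Type*} [TopologicalSpace M] [T2Space M] [ChartedSpace E M]
    [IsManifold 𝓘(ℝ, E) ∞ M] {C U : Set M} (hC : IsCompact C) (hU : IsOpen U) (hCU : C ⊆ U) :
    ∃ g : M → ℝ, ContMDiff 𝓘(ℝ, E) 𝓘(ℝ, ℝ) ∞ g ∧ (∀ x, 0 ≤ g x) ∧ (∀ x ∈ C, 0 < g x) ∧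
      tsupport g ⊆ U := by
  refine hC.induction_on (p := fun C => ∃ g : M → ℝ, ContMDiff 𝓘(ℝ, E) 𝓘(ℝ, ℝ) ∞ g ∧
    (∀ x, 0 ≤ g x) ∧ (∀ x ∈ C, 0 < g x) ∧ tsupport g ⊆ U) ?_ ?_ ?_ ?_
  · refine ⟨0, contMDiff_const, fun _ => le_rfl, by simp, by simp⟩
  · rintro s t hst ⟨g, h1, h2, h3, h4⟩
    exact ⟨g, h1, h2, fun x hx => h3 x (hst hx), h4⟩
  · rintro s t ⟨g, h1, h2, h3, h4⟩ ⟨g', h1', h2', h3', h4'⟩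
    refine ⟨g + g', h1.add h1', fun x => add_nonneg (h2 x) (h2' x), ?_, ?_⟩
    · rintro x (hx | hx)
      · exact add_pos_of_pos_of_nonneg (h3 x hx) (h2' x)
      · exact add_pos_of_nonneg_of_pos (h2 x) (h3' x hx)
    · exact (tsupport_add g g').trans (union_subset h4 h4')
  · intro x hx
    obtain ⟨f, -, hf⟩ := (SmoothBumpFunction.nhds_basis_tsupport (I := 𝓘(ℝ, E)) x).mem_iff.1
      (hU.mem_nhds (hCU hx))
    refine ⟨_, mem_nhdsWithin_of_mem_nhds f.eventuallyEq_one, f, f.contMDiff, fun _ => f.nonneg,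
      fun y hy => ?_, hf⟩
    have : f y = 1 := hy
    rw [this]; exact one_pos

open Filter Topology Function in
/-- Smooth partitions of unity on a paracompact manifold. -/
theorem exists_smoothPartitionOfUnity {E : Type*} [NormedAddCommGroup E] [NormedSpace ℝ E]
    [FiniteDimensional ℝ E] {M : Type*} [TopologicalSpace M] [T2Space M] [ParacompactSpace M]
    [ChartedSpace E M] [IsManifold 𝓘(ℝ, E) ∞ M] (U : M → Set M) (hU : ∀ x, U x ∈ 𝓝 x) :
    ∃ ρ : SmoothPartitionOfUnity M 𝓘(ℝ, E) M univ, ρ.IsSubordinate U := by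
  have : LocallyCompactSpace M := Manifold.locallyCompact_of_finiteDimensional 𝓘(ℝ, E)
  -- There may be uncountably many components, hence no σ-compactness. A locally finite refinement
  -- by sets `V i` inside compact `K i` is shrunk to closed, hence compact, `C i` that still cover,
  -- so one bump function per index suffices.
  choose K hKn hKU hKc using fun x => local_compact_nhds (hU x)
  obtain ⟨V, hVo, hVc, hVf, hVK⟩ := precise_refinement (fun x => interior (K x))
    (fun x => isOpen_interior)
    (eq_univ_of_forall fun x => mem_iUnion.2 ⟨x, mem_interior_iff_mem_nhds.2 (hKn x)⟩)
  obtain ⟨C, hCc, hCcl, hCV⟩ := exists_iUnion_eq_closed_subset hVo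
    (fun x => hVf.point_finite x) hVc
  have hcomp : ∀ i, IsCompact (C i) := fun i => (hKc i).of_isClosed_subset (hCcl i)
    ((hCV i).trans ((hVK i).trans interior_subset))
  choose g hg hg0 hgC hgV using fun i => exists_contMDiff_pos_on_compact (E := E)
    (hcomp i) (hVo i) (hCV i)
  have hlf : LocallyFinite fun i => support (g i) :=
    hVf.subset fun i => (subset_tsupport _).trans (hgV i)
  have hsum : ContMDiff 𝓘(ℝ, E) 𝓘(ℝ, ℝ) ∞ fun x => ∑ᶠ i, g i x := contMDiff_finsum hg hlf
  have hfin : ∀ x, (support fun i => g i x).Finite := fun x => hlf.point_finite x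
  have hpos : ∀ x, 0 < ∑ᶠ i, g i x := fun x => by
    obtain ⟨i, hi⟩ := mem_iUnion.1 (hCc ▸ mem_univ x)
    exact finsum_pos (fun j => hg0 j x) ⟨i, hgC i x hi⟩ (hfin x)
  have hsm : ∀ i, ContMDiff 𝓘(ℝ, E) 𝓘(ℝ, ℝ) ∞ fun x => g i x / ∑ᶠ j, g j x :=
    fun i => (hg i).div₀ hsum fun x => (hpos x).ne'
  have hsub : ∀ i, support (fun x => g i x / ∑ᶠ j, g j x) ⊆ support (g i) := fun i x hx => by
    rw [mem_support] at hx ⊢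
    intro h
    exact hx (by rw [h, zero_div])
  have hone : ∀ x, ∑ᶠ i, (g i x / ∑ᶠ j, g j x) = 1 := fun x => by
    simp_rw [div_eq_mul_inv]
    rw [← finsum_mul, mul_inv_cancel₀ (hpos x).ne']
  refine ⟨⟨fun i => ⟨_, hsm i⟩, hlf.subset hsub, fun i x => div_nonneg (hg0 i x) (hpos x).le,
    fun x _ => hone x, fun x => (hone x).le⟩, fun i => ?_⟩
  exact (closure_mono (hsub i)).trans ((hgV i).trans ((hVK i).trans
    (interior_subset.trans (hKU i))))

open Filter Topology Function in
/-- Neighbourhoods of the graph of `b` can be chosen fibrewise inside a member of a family of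
neighbourhoods of points of the graph. -/
theorem exists_isOpen_graph_nhds {M N : Type*} [TopologicalSpace M] [T2Space M]
    [ParacompactSpace M] [TopologicalSpace N] {b : M → N} (hb : Continuous b)
    (O : M → Set (M × N)) (hO : ∀ x, IsOpen (O x)) (hbO : ∀ x, (x, b x) ∈ O x) :
    ∃ W : Set (M × N), IsOpen W ∧ (∀ x, (x, b x) ∈ W) ∧
      ∀ x, ∃ x₀, ∀ z, (x, z) ∈ W → (x, z) ∈ O x₀ := by
  have hc : Continuous fun x => (x, b x) := by fun_prop
  obtain ⟨V, hVo, hVc, hVf, hVK⟩ := precise_refinement (fun x₀ => {x | (x, b x) ∈ O x₀})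
    (fun x => (hO x).preimage hc) (eq_univ_of_forall fun x => mem_iUnion.2 ⟨x, hbO x⟩)
  obtain ⟨C, hCc, hCcl, hCV⟩ := exists_iUnion_eq_closed_subset hVo
    (fun x => hVf.point_finite x) hVc
  have hlf : LocallyFinite fun i => (Prod.fst ⁻¹' C i ∩ (O i)ᶜ : Set (M × N)) :=
    ((hVf.subset hCV).preimage_continuous continuous_fst).subset fun i => inter_subset_left
  -- Over `C i` all points outside `O i` are removed. The removed sets are closed and locally
  -- finite, so their complement is open, and for `x ∈ C i` its whole fibre over `x` lies in `O i`.
  refine ⟨(⋃ i, Prod.fst ⁻¹' C i ∩ (O i)ᶜ)ᶜ, ?_, fun x => ?_, fun x => ?_⟩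
  · exact (hlf.isClosed_iUnion fun i =>
      ((hCcl i).preimage continuous_fst).inter (hO i).isClosed_compl).isOpen_compl
  · simp only [mem_compl_iff, mem_iUnion, not_exists]
    rintro i ⟨h1, h2⟩
    exact h2 (hVK i (hCV i h1))
  · obtain ⟨i, hi⟩ := mem_iUnion.1 (hCc ▸ mem_univ x)
    refine ⟨i, fun z hz => ?_⟩
    by_contra h
    exact hz (mem_iUnion.2 ⟨i, hi, h⟩)

/-! ### Tangent vectors in the coordinates of a fixed chart. -/

section FibreCoordinates

open Topology

variable {F : Type*} [NormedAddCommGroup F] [NormedSpace ℝ F]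
  {N : Type*} [TopologicalSpace N] [ChartedSpace F N]

/-- A smooth chart of `N`: a local homeomorphism to the model space, smooth in both directions. -/
structure IsSmoothChart (χ : OpenPartialHomeomorph N F) : Prop where
  smooth : ContMDiffOn 𝓘(ℝ, F) 𝓘(ℝ, F) ∞ χ χ.source
  smooth_symm : ContMDiffOn 𝓘(ℝ, F) 𝓘(ℝ, F) ∞ χ.symm χ.target

/-- The tangent vector at `y` with coordinates `w` in the preferred chart at `y`. -/
abbrev tangentMk (y : N) (w : F) : TangentBundle 𝓘(ℝ, F) N := ⟨y, w⟩

/-- The derivative at `y` of a chart `χ`, as a map `T_y N = F → F`. -/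
noncomputable def fibCoord (χ : OpenPartialHomeomorph N F) (y : N) : F →L[ℝ] F :=
  mfderiv 𝓘(ℝ, F) 𝓘(ℝ, F) χ y

/-- The inverse of the derivative at `y` of a chart `χ`, as a map `F → T_y N = F`. -/
noncomputable def fibInv (χ : OpenPartialHomeomorph N F) (y : N) : F →L[ℝ] F :=
  mfderiv 𝓘(ℝ, F) 𝓘(ℝ, F) χ.symm (χ y)

variable {χ : OpenPartialHomeomorph N F}

theorem IsSmoothChart.mdifferentiable (hχ : IsSmoothChart χ) :
    χ.MDifferentiable 𝓘(ℝ, F) 𝓘(ℝ, F) :=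
  ⟨hχ.smooth.mdifferentiableOn (by simp), hχ.smooth_symm.mdifferentiableOn (by simp)⟩

theorem IsSmoothChart.fibInv_fibCoord (hχ : IsSmoothChart χ) {y : N} (hy : y ∈ χ.source) (w : F) :
    fibInv χ y (fibCoord χ y w) = w :=
  DFunLike.congr_fun (hχ.mdifferentiable.symm_comp_deriv hy) w

theorem IsSmoothChart.fibCoord_fibInv (hχ : IsSmoothChart χ) {y : N} (hy : y ∈ χ.source) (w : F) :
    fibCoord χ y (fibInv χ y w) = w := by
  have := DFunLike.congr_fun (hχ.mdifferentiable.comp_symm_deriv (χ.map_source hy)) w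
  rw [χ.left_inv hy] at this
  exact this

variable [IsManifold 𝓘(ℝ, F) ∞ N]

theorem IsSmoothChart.contMDiffOn_fibCoord (hχ : IsSmoothChart χ) :
    ContMDiffOn 𝓘(ℝ, F).tangent 𝓘(ℝ, F) ∞
      (fun w : TangentBundle 𝓘(ℝ, F) N => fibCoord χ w.proj w.snd)
      (Bundle.TotalSpace.proj ⁻¹' χ.source) := by
  have h := hχ.smooth.contMDiffOn_tangentMapWithin (m := ∞) (by simp) χ.open_source.uniqueMDiffOn
  have h2 := (contMDiff_snd_tangentBundle_modelSpace F 𝓘(ℝ, F) (n := ∞)).comp_contMDiffOn h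
  refine h2.congr fun w hw => ?_
  simp only [Function.comp, tangentMapWithin, fibCoord]
  rw [mfderivWithin_of_isOpen χ.open_source hw]
  rfl

variable {G : Type*} [NormedAddCommGroup G] [NormedSpace ℝ G] {K : Type*} [TopologicalSpace K]
  {J : ModelWithCorners ℝ G K} {Q : Type*} [TopologicalSpace Q] [ChartedSpace K Q]

/-- The map is the tangent map of `χ.symm` applied to the vector `ξ q` based at `χ (y q)`. -/
theorem IsSmoothChart.contMDiffWithinAt_fibInv (hχ : IsSmoothChart χ) {y : Q → N} {ξ : Q → F}
    {s : Set Q} {q : Q} (hy : ContMDiffWithinAt J 𝓘(ℝ, F) ∞ y s q)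
    (hξ : ContMDiffWithinAt J 𝓘(ℝ, F) ∞ ξ s q) (hq : y q ∈ χ.source) :
    ContMDiffWithinAt J 𝓘(ℝ, F).tangent ∞
      (fun q => tangentMk (y q) (fibInv χ (y q) (ξ q))) s q := by
  have hχy : ContMDiffWithinAt J 𝓘(ℝ, F) ∞ (fun q => χ (y q)) s q :=
    (hχ.smooth.contMDiffAt (χ.open_source.mem_nhds hq)).comp_contMDiffWithinAt q hy
  have h1 : ContMDiffWithinAt J 𝓘(ℝ, F).tangent ∞
      (fun q => (⟨χ (y q), ξ q⟩ : TangentBundle 𝓘(ℝ, F) F)) s q := by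
    rw [Bundle.contMDiffWithinAt_totalSpace]
    refine ⟨hχy, ?_⟩
    simpa using hξ
  have h := hχ.smooth_symm.contMDiffOn_tangentMapWithin (m := ∞) (by simp)
    χ.open_target.uniqueMDiffOn
  have h2 := (h.contMDiffAt (x := (⟨χ (y q), ξ q⟩ : TangentBundle 𝓘(ℝ, F) F))
    ((χ.open_target.preimage (FiberBundle.continuous_proj F _)).mem_nhds
      (χ.map_source hq))).comp_contMDiffWithinAt q h1
  have key : ∀ q', y q' ∈ χ.source → tangentMk (y q') (fibInv χ (y q') (ξ q')) =
      tangentMapWithin 𝓘(ℝ, F) 𝓘(ℝ, F) χ.symm χ.target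
        (⟨χ (y q'), ξ q'⟩ : TangentBundle 𝓘(ℝ, F) F) := by
    intro q' hq'
    have : tangentMapWithin 𝓘(ℝ, F) 𝓘(ℝ, F) χ.symm χ.target
        (⟨χ (y q'), ξ q'⟩ : TangentBundle 𝓘(ℝ, F) F) =
        tangentMk (χ.symm (χ (y q'))) (fibInv χ (y q') (ξ q')) := by
      simp only [tangentMapWithin, fibInv]
      rw [mfderivWithin_of_isOpen χ.open_target (χ.map_source hq')]
      rfl
    rw [this, χ.left_inv hq']
  refine h2.congr_of_eventuallyEq ?_ (key q hq)
  filter_upwards [hy.continuousWithinAt (χ.open_source.mem_nhds hq)] with q' hq' using key q' hq'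

/-- The raw vector `w q` refers to the preferred chart at `y q`, which may jump with `q`. Only after
passing to one fixed chart is smoothness that of a function with values in `F`, and fibrewise
operations can be checked there. -/
theorem IsSmoothChart.contMDiffWithinAt_tangentMk_iff (hχ : IsSmoothChart χ) {y : Q → N}
    {w : Q → F} {s : Set Q} {q : Q} (hy : ContMDiffWithinAt J 𝓘(ℝ, F) ∞ y s q)
    (hq : y q ∈ χ.source) :
    ContMDiffWithinAt J 𝓘(ℝ, F).tangent ∞ (fun q => tangentMk (y q) (w q)) s q ↔
      ContMDiffWithinAt J 𝓘(ℝ, F) ∞ (fun q => fibCoord χ (y q) (w q)) s q := by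
  constructor
  · intro h
    exact (hχ.contMDiffOn_fibCoord.contMDiffAt (x := tangentMk (y q) (w q))
      ((χ.open_source.preimage (FiberBundle.continuous_proj F _)).mem_nhds
      hq)).comp_contMDiffWithinAt q h
  · intro h
    refine (hχ.contMDiffWithinAt_fibInv hy h hq).congr_of_eventuallyEq ?_ ?_
    · filter_upwards [hy.continuousWithinAt (χ.open_source.mem_nhds hq)] with q' hq'
      rw [hχ.fibInv_fibCoord hq']
    · rw [hχ.fibInv_fibCoord hq]

theorem isSmoothChart_chartAt (y : N) : IsSmoothChart (chartAt F y) :=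
  ⟨contMDiffOn_chart, contMDiffOn_chart_symm⟩

/-- Scalar multiplication in the fibres of the tangent bundle is smooth. -/
theorem ContMDiffWithinAt.tangentMk_smul {y : Q → N} {w : Q → F} {r : Q → ℝ} {s : Set Q} {q : Q}
    (hr : ContMDiffWithinAt J 𝓘(ℝ, ℝ) ∞ r s q)
    (h : ContMDiffWithinAt J 𝓘(ℝ, F).tangent ∞ (fun q => tangentMk (y q) (w q)) s q) :
    ContMDiffWithinAt J 𝓘(ℝ, F).tangent ∞ (fun q => tangentMk (y q) (r q • w q)) s q := by
  have hy : ContMDiffWithinAt J 𝓘(ℝ, F) ∞ y s q :=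
    (Bundle.contMDiffAt_proj (TangentSpace 𝓘(ℝ, F))).comp_contMDiffWithinAt q h
  have hχ := isSmoothChart_chartAt (F := F) (y q)
  rw [hχ.contMDiffWithinAt_tangentMk_iff hy (mem_chart_source F (y q))] at h ⊢
  simp only [map_smul]
  exact hr.smul h

theorem ContMDiffWithinAt.tangentMk_add {y : Q → N} {v w : Q → F} {s : Set Q} {q : Q}
    (hv : ContMDiffWithinAt J 𝓘(ℝ, F).tangent ∞ (fun q => tangentMk (y q) (v q)) s q)
    (hw : ContMDiffWithinAt J 𝓘(ℝ, F).tangent ∞ (fun q => tangentMk (y q) (w q)) s q) :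
    ContMDiffWithinAt J 𝓘(ℝ, F).tangent ∞ (fun q => tangentMk (y q) (v q + w q)) s q := by
  have hy : ContMDiffWithinAt J 𝓘(ℝ, F) ∞ y s q :=
    (Bundle.contMDiffAt_proj (TangentSpace 𝓘(ℝ, F))).comp_contMDiffWithinAt q hv
  have hχ := isSmoothChart_chartAt (F := F) (y q)
  rw [hχ.contMDiffWithinAt_tangentMk_iff hy (mem_chart_source F (y q))] at hv hw ⊢
  simp only [map_add]
  exact hv.add hw

end FibreCoordinates

/-! ### The constant rank theorem in vector spaces. -/

section ConstantRank

open Topology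

variable {E : Type*} [NormedAddCommGroup E] [NormedSpace ℝ E]
  {F : Type*} [NormedAddCommGroup F] [NormedSpace ℝ F]

/-- The inverse function theorem, with the inverse smooth on its whole domain. -/
theorem exists_openPartialHomeomorph_of_hasFDerivAt [CompleteSpace E] {f : E → F} {U : Set E}
    {a : E} (hU : IsOpen U) (ha : a ∈ U) (hf : ContDiffOn ℝ ∞ f U) {f' : E ≃L[ℝ] F}
    (hf' : HasFDerivAt f (f' : E →L[ℝ] F) a) :
    ∃ φ : OpenPartialHomeomorph E F, (∀ x, φ x = f x) ∧ a ∈ φ.source ∧ φ.source ⊆ U ∧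
      ContDiffOn ℝ ∞ φ φ.source ∧ ContDiffOn ℝ ∞ φ.symm φ.target := by
  have hfa : ContDiffAt ℝ ∞ f a := hf.contDiffAt (hU.mem_nhds ha)
  let φ₀ := hfa.toOpenPartialHomeomorph f hf' (by simp)
  -- Shrinking to the open set where the derivative stays invertible makes the inverse smooth on the
  -- whole target, not just at `f a`.
  let S : Set E := U ∩ fderiv ℝ f ⁻¹' range ((↑) : (E ≃L[ℝ] F) → E →L[ℝ] F)
  have hS : IsOpen S := (hf.continuousOn_fderiv_of_isOpen hU (by simp)).isOpen_inter_preimage hU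
    ContinuousLinearEquiv.isOpen
  have hsrc : (φ₀.restrOpen S hS).source = φ₀.source ∩ S := φ₀.restrOpen_source S hS
  refine ⟨φ₀.restrOpen S hS, fun x => rfl, ?_, ?_, ?_, ?_⟩
  · rw [hsrc]
    exact ⟨hfa.mem_toOpenPartialHomeomorph_source hf' (by simp), ha, f', hf'.fderiv.symm⟩
  · rw [hsrc]; exact fun x hx => hx.2.1
  · rw [hsrc]; exact hf.mono fun x hx => hx.2.1
  · intro y hy
    have hx := (φ₀.restrOpen S hS).map_target hy
    rw [hsrc] at hx
    obtain ⟨-, hxU, g', hg'⟩ := hx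
    have hd : ContDiffAt ℝ ∞ f ((φ₀.restrOpen S hS).symm y) := hf.contDiffAt (hU.mem_nhds hxU)
    refine ((φ₀.restrOpen S hS).contDiffAt_symm (f₀' := g') hy ?_ hd).contDiffWithinAt
    rw [hg']
    exact (hd.differentiableAt (by simp)).hasFDerivAt

/-- A linear map between finite-dimensional spaces has a generalized inverse. -/
theorem exists_generalized_inverse [FiniteDimensional ℝ E] [FiniteDimensional ℝ F]
    (A : E →L[ℝ] F) : ∃ B : F →L[ℝ] E, ∀ x, A (B (A x)) = A x := by
  obtain ⟨g, hg⟩ := A.toLinearMap.rangeRestrict.exists_rightInverse_of_surjective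
    A.toLinearMap.range_rangeRestrict
  obtain ⟨B, hB⟩ := g.exists_extend
  refine ⟨B.toContinuousLinearMap, fun x => ?_⟩
  have h1 : B (A x) = g ⟨A x, x, rfl⟩ := (LinearMap.congr_fun hB ⟨A x, x, rfl⟩)
  have h2 := LinearMap.congr_fun hg ⟨A x, x, rfl⟩
  have h3 := congrArg Subtype.val h2
  simp only [LinearMap.coe_toContinuousLinearMap']
  rw [h1]
  exact h3

/-- If `C D = A` and `D` has the same rank as `A`, then `ker A ⊆ ker D`. -/
theorem apply_eq_zero_of_finrank_range_eq [FiniteDimensional ℝ E] [FiniteDimensional ℝ F]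
    {G : Type*} [AddCommGroup G] [Module ℝ G] {A : E →ₗ[ℝ] G} {D : E →ₗ[ℝ] F} {C : F →ₗ[ℝ] G}
    (h : C ∘ₗ D = A)
    (hr : Module.finrank ℝ (LinearMap.range D) = Module.finrank ℝ (LinearMap.range A))
    {v : E} (hv : A v = 0) : D v = 0 := by
  have hle : LinearMap.ker D ≤ LinearMap.ker A := by
    rw [← h]; exact LinearMap.ker_le_ker_comp D C
  have h1 := D.finrank_range_add_finrank_ker
  have h2 := A.finrank_range_add_finrank_ker
  have heq := Submodule.eq_of_le_of_finrank_eq hle (by omega)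
  have : v ∈ LinearMap.ker D := by rw [heq]; exact hv
  exact this

/-- The constant rank theorem: in suitable coordinates a smooth map of constant rank is linear. -/
theorem exists_linearizing_coordinates [FiniteDimensional ℝ E] [FiniteDimensional ℝ F]
    {f : E → F} {U : Set E} {a : E} (hU : IsOpen U) (ha : a ∈ U) (hf : ContDiffOn ℝ ∞ f U)
    (hr : ∀ x ∈ U, Module.finrank ℝ (LinearMap.range (fderiv ℝ f x).toLinearMap) =
      Module.finrank ℝ (LinearMap.range (fderiv ℝ f a).toLinearMap)) :
    ∃ (φ : OpenPartialHomeomorph E E) (χ : OpenPartialHomeomorph F F) (A : E →L[ℝ] F),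
      a ∈ φ.source ∧ φ.source ⊆ U ∧ ContDiffOn ℝ ∞ φ φ.source ∧ ContDiffOn ℝ ∞ φ.symm φ.target ∧
      ContDiffOn ℝ ∞ χ χ.source ∧ ContDiffOn ℝ ∞ χ.symm χ.target ∧
      MapsTo f φ.source χ.source ∧ ∀ x ∈ φ.source, χ (f x) = A (φ x) := by
  have : CompleteSpace E := FiniteDimensional.complete ℝ E
  have : CompleteSpace F := FiniteDimensional.complete ℝ F
  set A := fderiv ℝ f a with hA
  obtain ⟨B, hB⟩ := exists_generalized_inverse A
  have hfd : ∀ x ∈ U, HasFDerivAt f (fderiv ℝ f x) x := fun x hx =>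
    ((hf.contDiffAt (hU.mem_nhds hx)).differentiableAt (by simp)).hasFDerivAt
  -- The derivative at `a` is the identity because that of `f` is `A`. Since `A B A = A`, this
  -- choice gives `A φ = A B f`.
  obtain ⟨φ, hφ, haφ, hφU, hφs, hφs'⟩ := exists_openPartialHomeomorph_of_hasFDerivAt
    (f := fun x => x + B (f x - A x)) (f' := ContinuousLinearEquiv.refl ℝ E) hU ha
    (contDiffOn_id.add (B.contDiff.comp_contDiffOn (hf.sub A.contDiff.contDiffOn))) (by
      have h := (hasFDerivAt_id a).add (B.hasFDerivAt.comp a ((hfd a ha).sub (A.hasFDerivAt)))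
      refine h.congr_fderiv ?_
      ext v
      simp [hA])
  have hAφ : ∀ x, A (φ x) = A (B (f x)) := fun x => by rw [hφ]; simp [hB]
  set g : E → F := f ∘ φ.symm with hg
  have hgs : ContDiffOn ℝ ∞ g φ.target :=
    hf.comp hφs' fun u hu => hφU (φ.map_target hu)
  have hgd : ∀ u ∈ φ.target, DifferentiableAt ℝ g u := fun u hu =>
    (hgs.contDiffAt (φ.open_target.mem_nhds hu)).differentiableAt (by simp)
  have hABg : ∀ u ∈ φ.target, A (B (g u)) = A u := fun u hu => by
    rw [hg, Function.comp_apply, ← hAφ, φ.right_inv hu]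
  have hφd : ∀ x ∈ φ.source, HasFDerivAt φ (fderiv ℝ φ x) x := fun x hx =>
    ((hφs.contDiffAt (φ.open_source.mem_nhds hx)).differentiableAt (by simp)).hasFDerivAt
  have hfgφ : ∀ x ∈ φ.source, fderiv ℝ f x = (fderiv ℝ g (φ x)).comp (fderiv ℝ φ x) := by
    intro x hx
    have h1 : HasFDerivAt (g ∘ φ) ((fderiv ℝ g (φ x)).comp (fderiv ℝ φ x)) x :=
      (hgd _ (φ.map_source hx)).hasFDerivAt.comp x (hφd x hx)
    refine ((h1.congr_of_eventuallyEq ?_).fderiv)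
    filter_upwards [φ.open_source.mem_nhds hx] with x' hx'
    simp [hg, φ.left_inv hx']
  -- Constant rank enters here. Differentiating `A B g = A` shows that `Dg` has at least the rank of
  -- `A`, and constancy of the rank of `Df` gives equality, so `ker A` is annihilated by `Dg` at
  -- every point.
  have hker : ∀ u ∈ φ.target, ∀ v, A v = 0 → fderiv ℝ g u v = 0 := by
    intro u hu v hv
    have h1 : (A.comp B).comp (fderiv ℝ g u) = A := by
      have h2 : HasFDerivAt ((A.comp B) ∘ g) ((A.comp B).comp (fderiv ℝ g u)) u :=
        (A.comp B).hasFDerivAt.comp u (hgd u hu).hasFDerivAt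
      have h3 : HasFDerivAt ((A.comp B) ∘ g) A u := by
        refine A.hasFDerivAt.congr_of_eventuallyEq ?_
        filter_upwards [φ.open_target.mem_nhds hu] with u' hu' using hABg u' hu'
      exact h2.unique h3
    have h1' : (A.comp B).toLinearMap ∘ₗ (fderiv ℝ g u).toLinearMap = A.toLinearMap :=
      congrArg ContinuousLinearMap.toLinearMap h1
    refine apply_eq_zero_of_finrank_range_eq h1' (le_antisymm ?_ ?_) hv
    · rw [← hr _ (hφU (φ.map_target hu))]
      have hgc : fderiv ℝ g u =
          (fderiv ℝ f (φ.symm u)).comp (fderiv ℝ φ.symm u) := by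
        have hd : DifferentiableAt ℝ φ.symm u :=
          (hφs'.contDiffAt (φ.open_target.mem_nhds hu)).differentiableAt (by simp)
        exact ((hfd _ (hφU (φ.map_target hu))).comp u hd.hasFDerivAt).fderiv
      refine Submodule.finrank_mono ?_
      rw [hgc]
      exact LinearMap.range_comp_le_range _ _
    · have h2 := LinearMap.range_comp (fderiv ℝ g u).toLinearMap (A.comp B).toLinearMap
      rw [h1'] at h2
      rw [h2]
      exact Submodule.finrank_map_le _ _
  -- the map `g` is constant along `ker A` near `φ a`
  obtain ⟨ε, hε, hball⟩ := Metric.isOpen_iff.1 φ.open_target _ (φ.map_source haφ)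
  -- `A (β (g u)) = A u`, so `β (g u) - u ∈ ker A`, and `g` takes the same value at both points when
  -- they lie in a common ball.
  set β : F → E := fun y => φ a + B (A (B y - φ a)) with hβ
  have hβs : ContDiff ℝ ∞ β := by fun_prop
  have hφa : A (φ a) = A (B (f a)) := hAφ a
  have hβa : β (f a) = φ a := by simp [hβ, hφa]
  have hconst : ∀ u ∈ Metric.ball (φ a) ε, β (g u) ∈ Metric.ball (φ a) ε → g (β (g u)) = g u := by
    intro u hu hu'
    have hz : A (β (g u) - u) = 0 := by
      simp [hβ, hB, hABg u (hball hu)]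
    let c : ℝ → F := fun t => g (u + t • (β (g u) - u))
    have hmem : ∀ t ∈ Icc (0:ℝ) 1, u + t • (β (g u) - u) ∈ Metric.ball (φ a) ε := fun t ht =>
      (convex_ball (φ a) ε).add_smul_sub_mem hu hu' ht
    have hcd : ∀ t ∈ Icc (0:ℝ) 1, HasDerivAt c 0 t := fun t ht => by
      have h1 : HasDerivAt (fun t : ℝ => u + t • (β (g u) - u)) (β (g u) - u) t := by
        simpa using ((hasDerivAt_id t).smul_const (β (g u) - u)).const_add u
      have h2 := (hgd _ (hball (hmem t ht))).hasFDerivAt.comp_hasDerivAt t h1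
      rwa [hker _ (hball (hmem t ht)) _ hz] at h2
    have h01 : c 1 = c 0 := constant_of_has_deriv_right_zero
      (fun t ht => (hcd t ht).continuousAt.continuousWithinAt)
      (fun t ht => (hcd t (Ico_subset_Icc_self ht)).hasDerivWithinAt) 1 (by simp)
    simpa [c] using h01
  have hdg : fderiv ℝ g (φ a) = A := by
    have h1 := hfgφ a haφ
    have h2 : fderiv ℝ φ a = ContinuousLinearMap.id ℝ E := by
      have h := (hasFDerivAt_id a).add (B.hasFDerivAt.comp a ((hfd a ha).sub (A.hasFDerivAt)))
      have h' : HasFDerivAt φ (ContinuousLinearMap.id ℝ E) a := by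
        refine (h.congr_fderiv ?_).congr_of_eventuallyEq (Filter.Eventually.of_forall hφ)
        ext v
        simp [hA]
      exact h'.fderiv
    rw [h2] at h1
    rw [hA, h1]; rfl
  -- On values of `f` near `f a` the first two terms cancel because `g (β (f x)) = f x`, leaving `A
  -- B f = A φ`. The derivative at `f a` is `id - A B A B + A B = id`.
  obtain ⟨χ, hχ, haχ, hχU, hχs, hχs'⟩ := exists_openPartialHomeomorph_of_hasFDerivAt
    (f := fun y => y - g (β y) + A (B y)) (f' := ContinuousLinearEquiv.refl ℝ F) (a := f a)
    (U := β ⁻¹' Metric.ball (φ a) ε) (Metric.isOpen_ball.preimage hβs.continuous)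
    (by simp [hβa, hε])
    ((contDiffOn_id.sub (hgs.comp hβs.contDiffOn fun y hy => hball hy)).add
      (A.comp B).contDiff.contDiffOn) (by
      have hβd : HasFDerivAt β (B.comp (A.comp B)) (f a) := by
        have := (B.comp A).hasFDerivAt.comp (f a) (B.hasFDerivAt.sub_const (φ a))
        exact this.const_add (φ a)
      have hgd' : HasFDerivAt g A (β (f a)) := by
        rw [hβa, ← hdg]
        exact (hgd _ (φ.map_source haφ)).hasFDerivAt
      have h := ((hasFDerivAt_id (f a)).sub (hgd'.comp (f a) hβd)).add
        (A.comp B).hasFDerivAt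
      refine h.congr_fderiv ?_
      ext v
      simp [hB])
  have hcf : ContinuousOn f φ.source := (hf.mono hφU).continuousOn
  have hO : IsOpen (φ.source ∩ (f ⁻¹' χ.source ∩ φ ⁻¹' Metric.ball (φ a) ε)) := by
    have h1 := hcf.isOpen_inter_preimage φ.open_source χ.open_source
    have h2 := φ.continuousOn.isOpen_inter_preimage φ.open_source
      (Metric.isOpen_ball (x := φ a) (ε := ε))
    rw [inter_inter_distrib_left]
    exact h1.inter h2
  set φ' := φ.restrOpen _ hO
  have hsrc : φ'.source ⊆ φ.source ∩ (f ⁻¹' χ.source ∩ φ ⁻¹' Metric.ball (φ a) ε) :=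
    fun x hx => hx.2
  have htgt : φ'.target ⊆ φ.target := fun u hu => hu.1
  refine ⟨φ', χ, A, ⟨haφ, haφ, haχ, by simp [hε]⟩, fun x hx => hφU hx.1, hφs.mono fun x hx => hx.1,
    hφs'.mono htgt, hχs, hχs', fun x hx => (hsrc hx).2.1, fun x hx => ?_⟩
  obtain ⟨h1, h2, h3⟩ := hsrc hx
  have hgx : g (φ x) = f x := by simp [hg, φ.left_inv h1]
  have h4 := hconst (φ x) h3 (by rw [hgx]; exact hχU h2)
  rw [hgx] at h4
  rw [hχ, h4]
  change f x - f x + A (B (f x)) = A (φ x)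
  rw [hAφ]; simp

end ConstantRank

/-! ### Charts of manifolds in which `f` is linear. -/

section AdaptedCharts

open Topology

variable {E : Type*} [NormedAddCommGroup E] [NormedSpace ℝ E]
  {F : Type*} [NormedAddCommGroup F] [NormedSpace ℝ F]
  {M : Type*} [TopologicalSpace M] [ChartedSpace E M]
  {N : Type*} [TopologicalSpace N] [ChartedSpace F N]

theorem IsSmoothChart.trans {e : OpenPartialHomeomorph N F} (he : IsSmoothChart e)
    {φ : OpenPartialHomeomorph F F} (hφ : ContDiffOn ℝ ∞ φ φ.source)
    (hφ' : ContDiffOn ℝ ∞ φ.symm φ.target) : IsSmoothChart (e.trans φ) := by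
  constructor
  · exact (contMDiffOn_iff_contDiffOn.2 hφ).comp
      (he.smooth.mono (by simp))
      (fun x hx => by rw [OpenPartialHomeomorph.trans_source] at hx; exact hx.2)
  · exact he.smooth_symm.comp
      ((contMDiffOn_iff_contDiffOn.2 hφ').mono (by simp))
      (fun x hx => by rw [OpenPartialHomeomorph.trans_target] at hx; exact hx.2)

theorem finrank_range_of_eq_comp {T D₂ : E →L[ℝ] F} {D₁ : F →L[ℝ] F} {D₃ : E →L[ℝ] E}
    (h : T = D₁.comp (D₂.comp D₃)) (h₁ : Function.Injective D₁) (h₃ : Function.Surjective D₃) :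
    Module.finrank ℝ (LinearMap.range T.toLinearMap) =
      Module.finrank ℝ (LinearMap.range D₂.toLinearMap) := by
  have h2 : LinearMap.range T.toLinearMap =
      (LinearMap.range D₂.toLinearMap).map D₁.toLinearMap := by
    rw [h, ← LinearMap.range_comp, ContinuousLinearMap.toLinearMap_comp,
      ContinuousLinearMap.toLinearMap_comp, ← LinearMap.comp_assoc]
    exact LinearMap.range_comp_of_range_eq_top _ (LinearMap.range_eq_top.2 h₃)
  rw [h2]
  exact (Submodule.equivMapOfInjective D₁.toLinearMap h₁ _).finrank_eq.symm

variable (E F) in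
/-- The derivative of `f` at `x`, as a map `T_x M = E → T_{f x} N = F`. -/
noncomputable def fibDeriv (f : M → N) (x : M) : E →L[ℝ] F := mfderiv 𝓘(ℝ, E) 𝓘(ℝ, F) f x

/-- Charts of source and target in which `f` is given by a linear map `A`. -/
structure IsLinearizing (f : M → N) (φ : OpenPartialHomeomorph M E)
    (χ : OpenPartialHomeomorph N F) (A : E →L[ℝ] F) : Prop where
  left : IsSmoothChart φ
  right : IsSmoothChart χ
  mapsTo : MapsTo f φ.source χ.source
  apply_eq : ∀ x ∈ φ.source, χ (f x) = A (φ x)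

/-- This is the derivative of the identity `χ ∘ f = A ∘ φ`. -/
theorem IsLinearizing.fibCoord_fibDeriv {f : M → N} {φ : OpenPartialHomeomorph M E}
    {χ : OpenPartialHomeomorph N F} {A : E →L[ℝ] F} (h : IsLinearizing f φ χ A) {x : M}
    (hx : x ∈ φ.source) (hf : MDifferentiableAt 𝓘(ℝ, E) 𝓘(ℝ, F) f x) (v : E) :
    fibCoord χ (f x) (fibDeriv E F f x v) = A (fibCoord φ x v) := by
  have h1 := mfderiv_comp x (h.right.mdifferentiable.mdifferentiableAt (h.mapsTo hx)) hf
  have h2 := mfderiv_comp x (A.mdifferentiableAt (x := φ x))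
    (h.left.mdifferentiable.mdifferentiableAt hx)
  have h3 : mfderiv 𝓘(ℝ, E) 𝓘(ℝ, F) (χ ∘ f) x = mfderiv 𝓘(ℝ, E) 𝓘(ℝ, F) (A ∘ φ) x := by
    refine Filter.EventuallyEq.mfderiv_eq ?_
    filter_upwards [φ.open_source.mem_nhds hx] with y hy using h.apply_eq y hy
  rw [h1, h2, A.mfderiv_eq] at h3
  exact DFunLike.congr_fun h3 v

variable [FiniteDimensional ℝ E] [FiniteDimensional ℝ F]
  [IsManifold 𝓘(ℝ, E) ∞ M] [IsManifold 𝓘(ℝ, F) ∞ N]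

/-- The constant rank theorem on manifolds. -/
theorem IsRegularMap.exists_isLinearizing {f : M → N} (hf : IsRegularMap E F f) (x₀ : M) :
    ∃ (φ : OpenPartialHomeomorph M E) (χ : OpenPartialHomeomorph N F) (A : E →L[ℝ] F),
      x₀ ∈ φ.source ∧ IsLinearizing f φ χ A := by
  obtain ⟨hfs, k, hk⟩ := hf
  set e := chartAt E x₀
  set e' := chartAt F (f x₀)
  have he : IsSmoothChart e := isSmoothChart_chartAt x₀
  have he' : IsSmoothChart e' := isSmoothChart_chartAt (f x₀)
  set g : E → F := fun u => e' (f (e.symm u)) with hg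
  set U : Set E := e.target ∩ e.symm ⁻¹' (f ⁻¹' e'.source) with hUdef
  have hU : IsOpen U := e.symm.isOpen_inter_preimage (e'.open_source.preimage hfs.continuous)
  have hx₀ : x₀ ∈ e.source := mem_chart_source E x₀
  have ha : e x₀ ∈ U := ⟨e.map_source hx₀, by
    simp only [mem_preimage, e.left_inv hx₀]; exact mem_chart_source F (f x₀)⟩
  have hgs : ContDiffOn ℝ ∞ g U := contMDiffOn_iff_contDiffOn.1 <|
    he'.smooth.comp (hfs.comp_contMDiffOn (he.smooth_symm.mono inter_subset_left))
      (fun u hu => hu.2)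
  have hrank : ∀ u ∈ U, Module.finrank ℝ (LinearMap.range (fderiv ℝ g u).toLinearMap) = k := by
    intro u hu
    have hd1 := he.mdifferentiable.symm.mdifferentiableAt (x := u) hu.1
    have hd2 : MDifferentiableAt 𝓘(ℝ, E) 𝓘(ℝ, F) f (e.symm u) := hfs.mdifferentiableAt (by simp)
    have hd3 := he'.mdifferentiable.mdifferentiableAt (x := f (e.symm u)) hu.2
    have h1 : mfderiv 𝓘(ℝ, E) 𝓘(ℝ, F) g u =
        (mfderiv 𝓘(ℝ, F) 𝓘(ℝ, F) e' (f (e.symm u))).comp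
          ((mfderiv 𝓘(ℝ, E) 𝓘(ℝ, F) f (e.symm u)).comp (mfderiv 𝓘(ℝ, E) 𝓘(ℝ, E) e.symm u)) := by
      rw [← mfderiv_comp u hd2 hd1]
      exact mfderiv_comp u hd3 (hd2.comp u hd1)
    rw [mfderiv_eq_fderiv] at h1
    exact (finrank_range_of_eq_comp h1 (he'.mdifferentiable.mfderiv_injective hu.2)
      (he.mdifferentiable.symm.mfderiv_surjective hu.1)).trans (hk _)
  obtain ⟨φ, χ, A, h1, h2, h3, h4, h5, h6, h7, h8⟩ := exists_linearizing_coordinates hU ha hgs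
    (fun u hu => (hrank u hu).trans (hrank _ ha).symm)
  refine ⟨e.trans φ, e'.trans χ, A, ?_, he.trans h3 h4, he'.trans h5 h6, ?_, ?_⟩
  · rw [OpenPartialHomeomorph.trans_source]; exact ⟨hx₀, h1⟩
  · intro x hx
    rw [OpenPartialHomeomorph.trans_source] at hx ⊢
    have h9 := h2 hx.2
    have h10 := h7 hx.2
    simp only [hUdef, hg, mem_inter_iff, mem_preimage, e.left_inv hx.1] at h9 h10
    exact ⟨h9.2, h10⟩
  · intro x hx
    rw [OpenPartialHomeomorph.trans_source] at hx
    have h10 := h8 _ hx.2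
    simp only [hg, e.left_inv hx.1] at h10
    exact h10

end AdaptedCharts

/-! ### Inverting fibrewise maps near the graph of `b`. -/

section FibrewiseInverse

open Topology Filter

variable {E : Type*} [NormedAddCommGroup E] [NormedSpace ℝ E]
  {F : Type*} [NormedAddCommGroup F] [NormedSpace ℝ F]
  {M : Type*} [TopologicalSpace M] [ChartedSpace E M] [IsManifold 𝓘(ℝ, E) ∞ M]
  {N : Type*} [TopologicalSpace N] [ChartedSpace F N] [IsManifold 𝓘(ℝ, F) ∞ N]

/-- A fibrewise map `ψ` into `b^* TN` whose vertical derivative along the graph of `b` is the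
identity is, in fibre coordinates, a local diffeomorphism near the graph. -/
theorem exists_local_diffeo_of_vertical_deriv [CompleteSpace E] [CompleteSpace F]
    {b : M → N} {ψ : M → N → F} (x₀ : M)
    (h1 : ∀ᶠ p : M × N in 𝓝 (x₀, b x₀), ContMDiffAt (𝓘(ℝ, E).prod 𝓘(ℝ, F)) 𝓘(ℝ, F).tangent ∞
      (fun p : M × N => tangentMk (b p.1) (ψ p.1 p.2)) p)
    (h3 : HasMFDerivAt 𝓘(ℝ, F) 𝓘(ℝ, F) (ψ x₀) (b x₀) (ContinuousLinearMap.id ℝ F)) :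
    ∃ T : OpenPartialHomeomorph (M × N) (M × F), (x₀, b x₀) ∈ T.source ∧
      (∀ p ∈ T.source, b p.1 ∈ (chartAt F (b x₀)).source ∧
        T p = (p.1, fibCoord (chartAt F (b x₀)) (b p.1) (ψ p.1 p.2)) ∧
        ContMDiffAt (𝓘(ℝ, E).prod 𝓘(ℝ, F)) 𝓘(ℝ, F).tangent ∞
          (fun p : M × N => tangentMk (b p.1) (ψ p.1 p.2)) p) ∧
      ContMDiffOn (𝓘(ℝ, E).prod 𝓘(ℝ, F)) (𝓘(ℝ, E).prod 𝓘(ℝ, F)) ∞ T.symm T.target := by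
  set e₀ := chartAt E x₀
  set e₁ := chartAt F (b x₀)
  have he₀ : IsSmoothChart e₀ := isSmoothChart_chartAt x₀
  have he₁ : IsSmoothChart e₁ := isSmoothChart_chartAt (b x₀)
  have hx₀ : x₀ ∈ e₀.source := mem_chart_source E x₀
  have hbx₀ : b x₀ ∈ e₁.source := mem_chart_source F (b x₀)
  have hbc : ∀ p : M × N, ContMDiffAt (𝓘(ℝ, E).prod 𝓘(ℝ, F)) 𝓘(ℝ, F).tangent ∞
      (fun p : M × N => tangentMk (b p.1) (ψ p.1 p.2)) p →
      ContMDiffAt (𝓘(ℝ, E).prod 𝓘(ℝ, F)) 𝓘(ℝ, F) ∞ (fun p : M × N => b p.1) p := fun p hp =>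
    (Bundle.contMDiffAt_proj (TangentSpace 𝓘(ℝ, F))
      (p := tangentMk (b p.1) (ψ p.1 p.2))).comp (f := fun p : M × N => tangentMk (b p.1) (ψ p.1 p.2)) p hp
  have h1' : ∀ᶠ p : M × N in 𝓝 (x₀, b x₀), b p.1 ∈ e₁.source :=
    (hbc _ h1.self_of_nhds).continuousAt (e₁.open_source.mem_nhds hbx₀)
  obtain ⟨O, hO, hOo, hmO⟩ := eventually_nhds_iff.1 (h1.and h1')
  set g : E × F → E × F := fun u =>
    (u.1, fibCoord e₁ (b (e₀.symm u.1)) (ψ (e₀.symm u.1) (e₁.symm u.2))) with hg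
  set U : Set (E × F) := (e₀.prod e₁).target ∩ (e₀.prod e₁).symm ⁻¹' O with hU
  have hUo : IsOpen U := (e₀.prod e₁).symm.isOpen_inter_preimage hOo
  have hsymm : ContMDiffOn (𝓘(ℝ, E).prod 𝓘(ℝ, F)) (𝓘(ℝ, E).prod 𝓘(ℝ, F)) ∞
      (e₀.prod e₁).symm (e₀.prod e₁).target :=
    he₀.smooth_symm.prodMap he₁.smooth_symm
  have hfib : ∀ p ∈ O, ContMDiffAt (𝓘(ℝ, E).prod 𝓘(ℝ, F)) 𝓘(ℝ, F) ∞
      (fun p : M × N => fibCoord e₁ (b p.1) (ψ p.1 p.2)) p := fun p hp =>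
    (he₁.contMDiffWithinAt_tangentMk_iff (s := univ) (hbc p (hO p hp).1) (hO p hp).2).1 (hO p hp).1
  have hgm : ContMDiffOn (𝓘(ℝ, E).prod 𝓘(ℝ, F)) (𝓘(ℝ, E).prod 𝓘(ℝ, F)) ∞ g U := by
    intro u hu
    refine contMDiffWithinAt_fst.prodMk ?_
    exact (hfib _ hu.2).comp_contMDiffWithinAt u ((hsymm u hu.1).mono inter_subset_left)
  have hgs : ContDiffOn ℝ ∞ g U := by
    rw [← modelWithCornersSelf_prod, chartedSpaceSelf_prod] at hgm
    exact contMDiffOn_iff_contDiffOn.1 hgm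
  have hu₀ : (e₀ x₀, e₁ (b x₀)) ∈ U := by
    refine ⟨⟨e₀.map_source hx₀, e₁.map_source hbx₀⟩, ?_⟩
    change (e₀.symm (e₀ x₀), e₁.symm (e₁ (b x₀))) ∈ O
    rwa [e₀.left_inv hx₀, e₁.left_inv hbx₀]
  have hgd : HasFDerivAt g (fderiv ℝ g (e₀ x₀, e₁ (b x₀))) (e₀ x₀, e₁ (b x₀)) :=
    ((hgs.contDiffAt (hUo.mem_nhds hu₀)).differentiableAt (by simp)).hasFDerivAt
  set D := fderiv ℝ g (e₀ x₀, e₁ (b x₀)) with hD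
  have hD1 : ∀ v, (D v).1 = v.1 := by
    intro v
    have h := (hasFDerivAt_fst (𝕜 := ℝ) (p := g (e₀ x₀, e₁ (b x₀)))).comp _ hgd
    have h' : HasFDerivAt (Prod.fst ∘ g) (ContinuousLinearMap.fst ℝ E F) (e₀ x₀, e₁ (b x₀)) :=
      hasFDerivAt_fst
    exact DFunLike.congr_fun (h.unique h') v
  -- The chart `e₁` serves both for the variable in `N` and for the fibre of `b^* TN`, so its
  -- derivative and inverse derivative at `b x₀` cancel.
  have hD2 : ∀ c, (D (0, c)).2 = c := by
    intro c
    have hin : HasFDerivAt (fun c : F => ((e₀ x₀, c) : E × F)) (ContinuousLinearMap.inr ℝ E F)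
        (e₁ (b x₀)) := hasFDerivAt_prodMk_right _ _
    have h := ((hasFDerivAt_snd (𝕜 := ℝ) (p := g (e₀ x₀, e₁ (b x₀)))).comp _ hgd).comp _ hin
    have h4 : HasMFDerivAt 𝓘(ℝ, F) 𝓘(ℝ, F) e₁.symm (e₁ (b x₀))
        (fibInv (F := F) e₁ (b x₀)) :=
      (he₁.mdifferentiable.symm.mdifferentiableAt (e₁.map_source hbx₀)).hasMFDerivAt
    have h3' : HasMFDerivAt 𝓘(ℝ, F) 𝓘(ℝ, F) (ψ x₀) (e₁.symm (e₁ (b x₀)))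
        (ContinuousLinearMap.id ℝ F) := by rw [e₁.left_inv hbx₀]; exact h3
    have h45 : HasMFDerivAt 𝓘(ℝ, F) 𝓘(ℝ, F) (ψ x₀ ∘ e₁.symm) (e₁ (b x₀))
        (fibInv (F := F) e₁ (b x₀)) :=
      HasMFDerivAt.comp _ h3' h4
    have h5 := (fibCoord e₁ (b x₀)).hasFDerivAt.comp (e₁ (b x₀)) h45.hasFDerivAt
    have h6 : (Prod.snd ∘ g) ∘ (fun c : F => ((e₀ x₀, c) : E × F)) =
        fibCoord e₁ (b x₀) ∘ (ψ x₀ ∘ e₁.symm) := by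
      funext c
      simp only [hg, Function.comp_apply, e₀.left_inv hx₀]
    rw [h6] at h
    have h7 := DFunLike.congr_fun (h.unique h5) c
    exact h7.trans (he₁.fibCoord_fibInv hbx₀ c)
  -- The derivative is block triangular with identity diagonal blocks, hence invertible.
  let D' : (E × F) ≃L[ℝ] E × F := (ContinuousLinearEquiv.refl ℝ E).skewProd
    (ContinuousLinearEquiv.refl ℝ F)
    ((ContinuousLinearMap.snd ℝ E F).comp (D.comp (ContinuousLinearMap.inl ℝ E F)))
  have hDD' : D = D' := by
    ext v
    · simp [hD1, D']
    · simp [D']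
    · simp [hD1, D']
    · simp [hD2, D']
  rw [hDD'] at hgd
  obtain ⟨Φ, hΦ, haΦ, hΦU, -, hΦs'⟩ := exists_openPartialHomeomorph_of_hasFDerivAt hUo hu₀ hgs hgd
  refine ⟨((e₀.prod e₁).trans Φ).trans (e₀.symm.prod (OpenPartialHomeomorph.refl F)), ?_, ?_, ?_⟩
  · simp only [OpenPartialHomeomorph.trans_source, OpenPartialHomeomorph.prod_source, mem_inter_iff,
      mem_preimage, OpenPartialHomeomorph.coe_trans, Function.comp_apply, hΦ, hg]
    refine ⟨⟨⟨hx₀, hbx₀⟩, haΦ⟩, e₀.map_source hx₀, mem_univ _⟩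
  · rintro p hp
    simp only [OpenPartialHomeomorph.trans_source, OpenPartialHomeomorph.prod_source, mem_inter_iff,
      mem_preimage] at hp
    obtain ⟨⟨⟨hp1, hp2⟩, hp3⟩, -⟩ := hp
    have hp4 : (e₀.symm (e₀ p.1), e₁.symm (e₁ p.2)) ∈ O := (hΦU hp3).2
    rw [e₀.left_inv hp1, e₁.left_inv hp2] at hp4
    refine ⟨(hO _ hp4).2, ?_, (hO _ hp4).1⟩
    change (e₀.symm (Φ (e₀ p.1, e₁ p.2)).1, (Φ (e₀ p.1, e₁ p.2)).2) = _
    rw [hΦ]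
    simp only [hg, e₀.left_inv hp1, e₁.left_inv hp2]
  · have hΦm : ContMDiffOn (𝓘(ℝ, E).prod 𝓘(ℝ, F)) (𝓘(ℝ, E).prod 𝓘(ℝ, F)) ∞ Φ.symm Φ.target := by
      rw [← modelWithCornersSelf_prod, chartedSpaceSelf_prod]
      exact contMDiffOn_iff_contDiffOn.2 hΦs'
    have h0 : ContMDiffOn (𝓘(ℝ, E).prod 𝓘(ℝ, F)) (𝓘(ℝ, E).prod 𝓘(ℝ, F)) ∞
        (e₀.symm.prod (OpenPartialHomeomorph.refl F)).symm
        (e₀.symm.prod (OpenPartialHomeomorph.refl F)).target :=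
      he₀.smooth.prodMap contMDiffOn_id
    refine hsymm.comp (hΦm.comp (h0.mono ?_) ?_) ?_
    · intro q hq; exact hq.1
    · intro q hq; exact hq.2.1
    · intro q hq; exact hq.2.2

variable (E) in
/-- A smooth fibrewise inverse `e` of a fibrewise map `ψ` into `b^* TN`, restricted to an open
neighbourhood `W` of the graph of `b`; the image of `W` is open in `b^* TN`. -/
structure FibrewiseInverse (b : M → N) (ψ : M → N → F) (W : Set (M × N)) (e : M → F → N) :
    Prop where
  isOpen : IsOpen W
  graph_mem : ∀ x, (x, b x) ∈ W
  smooth : ∀ p ∈ W, ContMDiffAt (𝓘(ℝ, E).prod 𝓘(ℝ, F)) 𝓘(ℝ, F).tangent ∞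
    (fun p : M × N => tangentMk (b p.1) (ψ p.1 p.2)) p
  left_inv : ∀ p ∈ W, e p.1 (ψ p.1 p.2) = p.2
  local_right_inv : ∀ p ∈ W, ContMDiffWithinAt (𝓘(ℝ, E).prod 𝓘(ℝ, F).tangent) 𝓘(ℝ, F) ∞
      (fun u : M × TangentBundle 𝓘(ℝ, F) N => e u.1 u.2.snd) (pullbackTangent F b)
      (p.1, tangentMk (b p.1) (ψ p.1 p.2)) ∧
    ∀ᶠ u in 𝓝[pullbackTangent F b] ((p.1, tangentMk (b p.1) (ψ p.1 p.2)) :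
      M × TangentBundle 𝓘(ℝ, F) N),
      (u.1, e u.1 u.2.snd) ∈ W ∧ ψ u.1 (e u.1 u.2.snd) = u.2.snd

/-- A fibrewise map into `b^* TN` whose vertical derivative along the graph of `b` is the identity
has a smooth fibrewise inverse near the graph. -/
theorem exists_fibrewise_inverse [CompleteSpace E] [CompleteSpace F] [T2Space M]
    [ParacompactSpace M] {b : M → N} (hb : Continuous b) {ψ : M → N → F}
    (h1 : ∀ x₀, ∀ᶠ p : M × N in 𝓝 (x₀, b x₀),
      ContMDiffAt (𝓘(ℝ, E).prod 𝓘(ℝ, F)) 𝓘(ℝ, F).tangent ∞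
        (fun p : M × N => tangentMk (b p.1) (ψ p.1 p.2)) p)
    (h3 : ∀ x, HasMFDerivAt 𝓘(ℝ, F) 𝓘(ℝ, F) (ψ x) (b x) (ContinuousLinearMap.id ℝ F))
    {P : M × N → Prop} (hP : ∀ x₀, ∀ᶠ p : M × N in 𝓝 (x₀, b x₀), P p) :
    ∃ (W : Set (M × N)) (e : M → F → N), FibrewiseInverse E b ψ W e ∧ ∀ p ∈ W, P p := by
  choose T hT0 hT hTs using fun x₀ => exists_local_diffeo_of_vertical_deriv x₀ (h1 x₀) (h3 x₀)
  choose O hOP hOo hmO using fun x₀ => eventually_nhds_iff.1 (hP x₀)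
  -- Each fibre of `W` lies in the source of a single `T x₀`. Fibrewise injectivity of `ψ` on all of
  -- `W` then follows from that of one local diffeomorphism.
  obtain ⟨W, hWo, hbW, hW⟩ := exists_isOpen_graph_nhds hb (fun x => (T x).source ∩ O x)
    (fun x => (T x).open_source.inter (hOo x)) (fun x => ⟨hT0 x, hmO x⟩)
  have hinj : ∀ x z z', (x, z) ∈ W → (x, z') ∈ W → ψ x z = ψ x z' → z = z' := by
    intro x z z' hz hz' h
    obtain ⟨x₀, hx₀⟩ := hW x
    have h1 := (hT x₀ _ (hx₀ z hz).1).2.1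
    have h2 := (hT x₀ _ (hx₀ z' hz').1).2.1
    have h3 : T x₀ (x, z) = T x₀ (x, z') := by rw [h1, h2]; simp only [h]
    exact congrArg Prod.snd ((T x₀).injOn (hx₀ z hz).1 (hx₀ z' hz').1 h3)
  -- Outside the image of the fibre of `W` the value is arbitrary.
  let e : M → F → N := fun x w =>
    haveI : Nonempty N := ⟨b x⟩
    Function.invFunOn (ψ x) {z | (x, z) ∈ W} w
  have he : ∀ p ∈ W, e p.1 (ψ p.1 p.2) = p.2 := by
    rintro ⟨x, z⟩ hp
    have : Nonempty N := ⟨b x⟩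
    have hex : ∃ z' ∈ {z | (x, z) ∈ W}, ψ x z' = ψ x z := ⟨z, hp, rfl⟩
    exact hinj x _ _ (Function.invFunOn_mem hex) hp (Function.invFunOn_eq hex)
  refine ⟨W, e, ⟨hWo, hbW, ?_, he, ?_⟩, fun p hp => ?_⟩
  · rintro ⟨x, z⟩ hp
    obtain ⟨x₀, hx₀⟩ := hW x
    exact (hT x₀ _ (hx₀ z hp).1).2.2
  · rintro ⟨x, z⟩ hp
    obtain ⟨x₀, hx₀⟩ := hW x
    have hpT := (hx₀ z hp).1
    obtain ⟨hbs, hTp, hsm⟩ := hT x₀ _ hpT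
    simp only at hbs hTp hsm ⊢
    set u₀ : M × TangentBundle 𝓘(ℝ, F) N := (x, tangentMk (b x) (ψ x z)) with hu₀
    set χ := chartAt F (b x₀) with hχdef
    have hχ : IsSmoothChart χ := isSmoothChart_chartAt (b x₀)
    set c : M × TangentBundle 𝓘(ℝ, F) N → M × F := fun u =>
      (u.1, fibCoord χ u.2.proj u.2.snd) with hc
    have hcs : ContMDiffAt (𝓘(ℝ, E).prod 𝓘(ℝ, F).tangent) (𝓘(ℝ, E).prod 𝓘(ℝ, F)) ∞ c u₀ := by
      refine contMDiffAt_fst.prodMk ?_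
      exact ContMDiffAt.comp u₀ (hχ.contMDiffOn_fibCoord.contMDiffAt
        ((χ.open_source.preimage (FiberBundle.continuous_proj F _)).mem_nhds hbs)) contMDiffAt_snd
    have hcu₀ : c u₀ = T x₀ (x, z) := by rw [hTp]
    have hct : c u₀ ∈ (T x₀).target := by rw [hcu₀]; exact (T x₀).map_source hpT
    have hGs : ContMDiffAt (𝓘(ℝ, E).prod 𝓘(ℝ, F).tangent) (𝓘(ℝ, E).prod 𝓘(ℝ, F)) ∞
        ((T x₀).symm ∘ c) u₀ :=
      ContMDiffAt.comp u₀ ((hTs x₀).contMDiffAt ((T x₀).open_target.mem_nhds hct)) hcs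
    have hGu₀ : ((T x₀).symm ∘ c) u₀ = (x, z) := by
      rw [Function.comp_apply, hcu₀, (T x₀).left_inv hpT]
    -- By injectivity, near `u₀` the chosen inverse agrees with the second component of the smooth
    -- local inverse, which yields both its smoothness and the openness of the image.
    have hev : ∀ᶠ u in 𝓝[pullbackTangent F b] u₀, e u.1 u.2.snd = ((T x₀).symm (c u)).2 ∧
        (u.1, e u.1 u.2.snd) ∈ W ∧ ψ u.1 (e u.1 u.2.snd) = u.2.snd := by
      have hG1 : ∀ᶠ u in 𝓝 u₀, ((T x₀).symm ∘ c) u ∈ W :=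
        hGs.continuousAt (by rw [hGu₀]; exact hWo.mem_nhds hp)
      have hG2 : ∀ᶠ u in 𝓝 u₀, c u ∈ (T x₀).target :=
        hcs.continuousAt ((T x₀).open_target.mem_nhds hct)
      filter_upwards [hG1.filter_mono nhdsWithin_le_nhds, hG2.filter_mono nhdsWithin_le_nhds,
        self_mem_nhdsWithin] with u hu1 hu2 hu3
      have hu3' : u.2.proj = b u.1 := hu3
      obtain ⟨h4, h5, -⟩ := hT x₀ _ ((T x₀).map_target hu2)
      rw [(T x₀).right_inv hu2] at h5
      set q := (T x₀).symm (c u) with hq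
      have hq1 : q.1 = u.1 := (congrArg Prod.fst h5).symm
      have h6 : fibCoord χ u.2.proj u.2.snd = fibCoord χ (b q.1) (ψ q.1 q.2) :=
        congrArg Prod.snd h5
      have h7 : ψ u.1 q.2 = u.2.snd := by
        rw [hq1, hu3'] at h6
        rw [hq1] at h4
        have h8 := congrArg (fibInv χ (b u.1)) h6
        rw [hχ.fibInv_fibCoord h4] at h8
        exact h8.symm.trans (hχ.fibInv_fibCoord h4 _)
      have hqW : (u.1, q.2) ∈ W := by rw [← hq1]; exact hu1
      have h9 : e u.1 u.2.snd = q.2 := by rw [← h7]; exact he _ hqW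
      refine ⟨h9, ?_, ?_⟩
      · rw [h9]; exact hqW
      · rw [h9]; exact h7
    refine ⟨?_, hev.mono fun u hu => hu.2⟩
    refine (contMDiffAt_snd.comp u₀ hGs).contMDiffWithinAt.congr_of_eventuallyEq
      (hev.mono fun u hu => hu.1) ?_
    change e x (ψ x z) = (((T x₀).symm ∘ c) u₀).2
    rw [hGu₀]
    exact he _ hp
  · obtain ⟨x₀, hx₀⟩ := hW p.1
    exact hOP x₀ _ (hx₀ p.2 hp).2

end FibrewiseInverse

/-! ### Averaging chart differences into a fibrewise logarithm. -/

section Patching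

open Topology Filter

variable {E : Type*} [NormedAddCommGroup E] [NormedSpace ℝ E]
  {F : Type*} [NormedAddCommGroup F] [NormedSpace ℝ F]
  {M : Type*} [TopologicalSpace M] [ChartedSpace E M]
  {N : Type*} [TopologicalSpace N] [ChartedSpace F N]
  {ι : Type*} (ρ : SmoothPartitionOfUnity ι 𝓘(ℝ, E) M univ)

/-- The combination of a family of vectors with the weights of a partition of unity at `x`. -/
noncomputable def patch {A : Type*} [AddCommGroup A] [Module ℝ A] (x : M) (φ : ι → A) : A :=
  ∑ i ∈ ρ.finsupport x, ρ i x • φ i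

variable {ρ}

theorem patch_eq_sum {A : Type*} [AddCommGroup A] [Module ℝ A] {x : M} {t : Finset ι}
    (ht : ρ.finsupport x ⊆ t) (φ : ι → A) : patch ρ x φ = ∑ i ∈ t, ρ i x • φ i := by
  refine Finset.sum_subset ht fun i _ hi => ?_
  rw [SmoothPartitionOfUnity.mem_finsupport, Function.notMem_support] at hi
  rw [hi, zero_smul]

theorem mem_tsupport_of_mem_finsupport {x : M} {i : ι} (hi : i ∈ ρ.finsupport x) :
    x ∈ tsupport (ρ i) :=
  (ρ.mem_fintsupport_iff x i).1 (ρ.finsupport_subset_fintsupport x hi)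

theorem patch_congr {A : Type*} [AddCommGroup A] [Module ℝ A] {x : M} {φ φ' : ι → A}
    (h : ∀ i, x ∈ tsupport (ρ i) → φ i = φ' i) : patch ρ x φ = patch ρ x φ' :=
  Finset.sum_congr rfl fun i hi => by rw [h i (mem_tsupport_of_mem_finsupport hi)]

theorem patch_const {A : Type*} [AddCommGroup A] [Module ℝ A] {x : M} (a : A) :
    patch ρ x (fun _ => a) = a := by
  rw [patch, ← Finset.sum_smul, ρ.sum_finsupport x (mem_univ x), one_smul]

theorem map_patch {A B : Type*} [AddCommGroup A] [Module ℝ A] [AddCommGroup B] [Module ℝ B]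
    (L : A →ₗ[ℝ] B) (x : M) (φ : ι → A) : L (patch ρ x φ) = patch ρ x (fun i => L (φ i)) := by
  simp [patch]

section Smooth

variable {G : Type*} [NormedAddCommGroup G] [NormedSpace ℝ G] {K : Type*} [TopologicalSpace K]
  {J : ModelWithCorners ℝ G K} {Q : Type*} [TopologicalSpace Q] [ChartedSpace K Q]

/-- The finite support moves with the point, but nearby it stays inside one fixed finite set, so
locally `patch` is an ordinary finite sum. -/
theorem eventually_patch_eq_sum {A : Type*} [AddCommGroup A] [Module ℝ A] {p : Q → M} {s : Set Q}
    {q : Q} (hp : ContinuousWithinAt p s q) :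
    ∀ᶠ q' in 𝓝[s] q, ∀ φ : ι → A,
      patch ρ (p q') φ = ∑ i ∈ ρ.fintsupport (p q), ρ i (p q') • φ i := by
  filter_upwards [hp.eventually (ρ.eventually_finsupport_subset (p q))] with q' hq' φ
  exact patch_eq_sum hq' φ

theorem contMDiffWithinAt_patch {A : Type*} [NormedAddCommGroup A] [NormedSpace ℝ A] {p : Q → M}
    {φ : ι → Q → A} {s : Set Q} {q : Q} (hp : ContMDiffWithinAt J 𝓘(ℝ, E) ∞ p s q)
    (hφ : ∀ i, p q ∈ tsupport (ρ i) → ContMDiffWithinAt J 𝓘(ℝ, A) ∞ (φ i) s q) :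
    ContMDiffWithinAt J 𝓘(ℝ, A) ∞ (fun q => patch ρ (p q) fun i => φ i q) s q := by
  have h : ContMDiffWithinAt J 𝓘(ℝ, A) ∞
      (fun q' => ∑ i ∈ ρ.fintsupport (p q), ρ i (p q') • φ i q') s q :=
    contMDiffWithinAt_finsetSum fun i hi =>
      ((ρ i).contMDiff.contMDiffAt.comp_contMDiffWithinAt q hp).smul
        (hφ i ((ρ.mem_fintsupport_iff _ i).1 hi))
  refine h.congr_of_eventuallyEq ?_ (patch_eq_sum (ρ.finsupport_subset_fintsupport _) _)
  filter_upwards [eventually_patch_eq_sum (A := A) (ρ := ρ) hp.continuousWithinAt] with q' hq'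
  exact hq' _

/-- Fibre coordinates are linear, hence commute with `patch`, which reduces the claim to
vector-valued maps. -/
theorem contMDiffWithinAt_tangentMk_patch [IsManifold 𝓘(ℝ, F) ∞ N] {p : Q → M} {y : Q → N}
    {φ : ι → Q → F} {s : Set Q} {q : Q} (hp : ContMDiffWithinAt J 𝓘(ℝ, E) ∞ p s q)
    (hy : ContMDiffWithinAt J 𝓘(ℝ, F) ∞ y s q)
    (hφ : ∀ i, p q ∈ tsupport (ρ i) →
      ContMDiffWithinAt J 𝓘(ℝ, F).tangent ∞ (fun q => tangentMk (y q) (φ i q)) s q) :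
    ContMDiffWithinAt J 𝓘(ℝ, F).tangent ∞
      (fun q => tangentMk (y q) (patch ρ (p q) fun i => φ i q)) s q := by
  have hχ := isSmoothChart_chartAt (F := F) (y q)
  rw [hχ.contMDiffWithinAt_tangentMk_iff hy (mem_chart_source F (y q))]
  have h := contMDiffWithinAt_patch (ρ := ρ) hp fun i hi =>
    (hχ.contMDiffWithinAt_tangentMk_iff hy (mem_chart_source F (y q))).1 (hφ i hi)
  refine h.congr (fun q' _ => map_patch (fibCoord _ (y q')).toLinearMap _ _)
    (map_patch (fibCoord _ (y q)).toLinearMap _ _)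

end Smooth

/-- The difference of `z` and `y` in a chart, as a tangent vector at `y`. -/
noncomputable def chartDiff (χ : OpenPartialHomeomorph N F) (y z : N) : F :=
  fibInv χ y (χ z - χ y)

variable (ρ) in
/-- A fibrewise logarithm along `b`: `tangentLog ρ b χ x z ∈ T_{b x} N` for `z` close to `b x`. -/
noncomputable def tangentLog (b : M → N) (χ : ι → OpenPartialHomeomorph N F) (x : M) (z : N) : F :=
  patch ρ x fun i => chartDiff (χ i) (b x) z

variable {b : M → N} {χ : ι → OpenPartialHomeomorph N F}

theorem tangentLog_self (x : M) : tangentLog ρ b χ x (b x) = 0 := by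
  simp [tangentLog, chartDiff, patch]

theorem IsSmoothChart.hasMFDerivAt_chartDiff {χ : OpenPartialHomeomorph N F} (hχ : IsSmoothChart χ)
    {y : N} (hy : y ∈ χ.source) :
    HasMFDerivAt 𝓘(ℝ, F) 𝓘(ℝ, F) (chartDiff χ y) y (ContinuousLinearMap.id ℝ F) := by
  have h1 : HasMFDerivAt 𝓘(ℝ, F) 𝓘(ℝ, F) χ y (fibCoord (F := F) χ y) :=
    (hχ.mdifferentiable.mdifferentiableAt hy).hasMFDerivAt
  have h2 : HasFDerivAt (fun u : F => fibInv χ y (u - χ y)) (fibInv χ y) (χ y) :=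
    (fibInv χ y).hasFDerivAt.comp (χ y) ((hasFDerivAt_id (χ y)).sub_const (χ y))
  have h3 : HasMFDerivAt 𝓘(ℝ, F) 𝓘(ℝ, F) (chartDiff χ y) y
      ((fibInv (F := F) χ y).comp (fibCoord (F := F) χ y)) :=
    HasMFDerivAt.comp (f := χ) y h2.hasMFDerivAt h1
  have h4 : (fibInv χ y).comp (fibCoord χ y) = ContinuousLinearMap.id ℝ F := by
    ext w; exact hχ.fibInv_fibCoord hy w
  exact h3.congr_mfderiv h4

/-- Every chart difference contributing at `x` has derivative the identity at `b x`, and the weights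
sum to one. They depend on `x` only, so differentiating in `z` leaves them alone. -/
theorem hasMFDerivAt_tangentLog (hχ : ∀ i, IsSmoothChart (χ i))
    (hs : ∀ i, tsupport (ρ i) ⊆ b ⁻¹' (χ i).source) (x : M) :
    HasMFDerivAt 𝓘(ℝ, F) 𝓘(ℝ, F) (tangentLog ρ b χ x) (b x) (ContinuousLinearMap.id ℝ F) := by
  have h : ∀ t : Finset ι, t ⊆ ρ.finsupport x → HasMFDerivAt 𝓘(ℝ, F) 𝓘(ℝ, F)
      (∑ i ∈ t, ρ i x • chartDiff (χ i) (b x)) (b x)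
      ((∑ i ∈ t, ρ i x) • ContinuousLinearMap.id ℝ F) := by
    classical
    intro t
    induction t using Finset.induction_on with
    | empty =>
      intro _
      have h0 : ((∑ i ∈ (∅ : Finset ι), ρ i x) • ContinuousLinearMap.id ℝ F) = 0 := by simp
      exact (hasMFDerivAt_const (0 : F) (b x)).congr_mfderiv h0.symm
    | insert i t hi ih =>
      intro ht
      rw [Finset.insert_subset_iff] at ht
      have h0 : ((∑ i ∈ insert i t, ρ i x) • ContinuousLinearMap.id ℝ F) =
          ρ i x • ContinuousLinearMap.id ℝ F + (∑ i ∈ t, ρ i x) • ContinuousLinearMap.id ℝ F := by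
        rw [Finset.sum_insert hi, add_smul]
      rw [Finset.sum_insert hi]
      exact ((((hχ i).hasMFDerivAt_chartDiff
        (hs i (mem_tsupport_of_mem_finsupport ht.1))).const_smul (ρ i x)).add
        (ih ht.2)).congr_mfderiv h0.symm
  have h1 := h _ subset_rfl
  rw [ρ.sum_finsupport x (mem_univ x)] at h1
  replace h1 := h1.congr_mfderiv (one_smul ℝ (ContinuousLinearMap.id ℝ F))
  have h2 : tangentLog ρ b χ x = ∑ i ∈ ρ.finsupport x, ρ i x • chartDiff (χ i) (b x) := by
    funext z
    simp [tangentLog, patch]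
  rwa [h2]

/-- Near `(x₀, b x₀)` only the finitely many charts indexed by `ρ.fintsupport x₀` contribute, and
all of them contain both `b p.1` and `p.2`. -/
theorem eventually_contMDiffAt_tangentLog [IsManifold 𝓘(ℝ, F) ∞ N] (hχ : ∀ i, IsSmoothChart (χ i))
    (hb : ContMDiff 𝓘(ℝ, E) 𝓘(ℝ, F) ∞ b) (hs : ∀ i, tsupport (ρ i) ⊆ b ⁻¹' (χ i).source) (x₀ : M) :
    ∀ᶠ p : M × N in 𝓝 (x₀, b x₀), ContMDiffAt (𝓘(ℝ, E).prod 𝓘(ℝ, F)) 𝓘(ℝ, F).tangent ∞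
      (fun p : M × N => tangentMk (b p.1) (tangentLog ρ b χ p.1 p.2)) p := by
  have h1 : ∀ᶠ p : M × N in 𝓝 (x₀, b x₀), ∀ i ∈ ρ.fintsupport x₀,
      b p.1 ∈ (χ i).source ∧ p.2 ∈ (χ i).source := by
    refine (Filter.eventually_all_finset _).2 fun i hi => ?_
    have hx : b x₀ ∈ (χ i).source := hs i ((ρ.mem_fintsupport_iff x₀ i).1 hi)
    have hc : Continuous fun p : M × N => b p.1 := hb.continuous.comp continuous_fst
    have h1 : ∀ᶠ p : M × N in 𝓝 (x₀, b x₀), b p.1 ∈ (χ i).source :=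
      hc.continuousAt.eventually ((χ i).open_source.mem_nhds hx)
    have h2 : ∀ᶠ p : M × N in 𝓝 (x₀, b x₀), p.2 ∈ (χ i).source :=
      continuousAt_snd.eventually ((χ i).open_source.mem_nhds hx)
    exact h1.and h2
  have h2 : ∀ᶠ p : M × N in 𝓝 (x₀, b x₀), ρ.fintsupport p.1 ⊆ ρ.fintsupport x₀ :=
    (continuousAt_fst (p := (x₀, b x₀))).eventually (ρ.eventually_fintsupport_subset x₀)
  filter_upwards [h1, h2] with p hp hp'
  have hbp : ContMDiffAt (𝓘(ℝ, E).prod 𝓘(ℝ, F)) 𝓘(ℝ, F) ∞ (fun p : M × N => b p.1) p :=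
    hb.contMDiffAt.comp p contMDiffAt_fst
  refine contMDiffWithinAt_tangentMk_patch (ρ := ρ) (s := univ) contMDiffAt_fst hbp fun i hi => ?_
  obtain ⟨h3, h4⟩ := hp i (hp' ((ρ.mem_fintsupport_iff _ i).2 hi))
  refine (hχ i).contMDiffWithinAt_fibInv hbp (ContMDiffWithinAt.sub ?_ ?_) h3
  · exact ((hχ i).smooth.contMDiffAt ((χ i).open_source.mem_nhds h4)).comp p contMDiffAt_snd
  · exact ((hχ i).smooth.contMDiffAt ((χ i).open_source.mem_nhds h3)).comp p hbp

/-- Logarithms built from linearizing charts of `f` intertwine `Tf` and `f`. -/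
theorem fibDeriv_tangentLog {f : M → N} {φ : ι → OpenPartialHomeomorph M E} {A : ι → E →L[ℝ] F}
    (hl : ∀ i, IsLinearizing f (φ i) (χ i) (A i)) {x y : M}
    (hf : MDifferentiableAt 𝓘(ℝ, E) 𝓘(ℝ, F) f x)
    (h : ∀ i, x ∈ tsupport (ρ i) → x ∈ (φ i).source ∧ y ∈ (φ i).source) :
    fibDeriv E F f x (tangentLog ρ id φ x y) = tangentLog ρ f χ x (f y) := by
  set D := fibDeriv E F f x with hD
  refine (map_patch D.toLinearMap _ _).trans (patch_congr fun i hi => ?_)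
  obtain ⟨hx, hy⟩ := h i hi
  set u : E := chartDiff (φ i) x y with hu
  have h1 : fibCoord (χ i) (f x) (D u) = A i (fibCoord (φ i) x u) :=
    (hl i).fibCoord_fibDeriv hx hf u
  -- In a pair of linearizing charts, `A (φ y - φ x) = χ (f y) - χ (f x)`.
  have h2 : fibCoord (χ i) (f x) (D u) = χ i (f y) - χ i (f x) := by
    rw [h1, hu, chartDiff, (hl i).left.fibCoord_fibInv hx, map_sub, (hl i).apply_eq x hx,
      (hl i).apply_eq y hy]
  change D u = chartDiff (χ i) (f x) (f y)
  rw [chartDiff, ← h2, (hl i).right.fibInv_fibCoord ((hl i).mapsTo hx)]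

end Patching

/-! ### Smooth fibre norms and small disc bundles. -/

section FibreNorms

open Topology Filter

variable {E : Type*} [NormedAddCommGroup E] [NormedSpace ℝ E]
  {F : Type*} [NormedAddCommGroup F] [NormedSpace ℝ F]
  {M : Type*} [TopologicalSpace M] [ChartedSpace E M]
  {N : Type*} [TopologicalSpace N] [ChartedSpace F N]
  {G : Type*} [NormedAddCommGroup G] [NormedSpace ℝ G] {K : Type*} [TopologicalSpace K]
  {J : ModelWithCorners ℝ G K} {Q : Type*} [TopologicalSpace Q] [ChartedSpace K Q]
  {ι : Type*} {ρ : SmoothPartitionOfUnity ι 𝓘(ℝ, E) M univ}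
  {b : M → N} {χ : ι → OpenPartialHomeomorph N F}

theorem ContMDiffWithinAt.of_tangentMk [IsManifold 𝓘(ℝ, F) ∞ N] {y : Q → N} {w : Q → F} {s : Set Q} {q : Q}
    (h : ContMDiffWithinAt J 𝓘(ℝ, F).tangent ∞ (fun q => tangentMk (y q) (w q)) s q) :
    ContMDiffWithinAt J 𝓘(ℝ, F) ∞ y s q :=
  (Bundle.contMDiffAt_proj (TangentSpace 𝓘(ℝ, F))).comp_contMDiffWithinAt q h

section FibreSq

variable [FiniteDimensional ℝ F]

variable (ρ b χ) in
/-- The square of a Euclidean norm on the fibres of `b^* TN`. -/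
noncomputable def fibreSq (x : M) (w : F) : ℝ :=
  patch ρ x fun i => ‖toEuclidean (fibCoord (χ i) (b x) w)‖ ^ 2

theorem fibreSq_nonneg (x : M) (w : F) : 0 ≤ fibreSq ρ b χ x w :=
  Finset.sum_nonneg fun i _ => mul_nonneg (ρ.nonneg i x) (sq_nonneg _)

theorem fibreSq_smul (x : M) (t : ℝ) (w : F) :
    fibreSq ρ b χ x (t • w) = t ^ 2 * fibreSq ρ b χ x w := by
  simp only [fibreSq, patch, Finset.mul_sum, map_smul, norm_smul, mul_pow, smul_eq_mul,
    Real.norm_eq_abs, sq_abs]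
  exact Finset.sum_congr rfl fun i _ => by ring

theorem fibreSq_eq_zero (hχ : ∀ i, IsSmoothChart (χ i))
    (hs : ∀ i, tsupport (ρ i) ⊆ b ⁻¹' (χ i).source) {x : M} {w : F}
    (h : fibreSq ρ b χ x w = 0) : w = 0 := by
  obtain ⟨i, hi⟩ := ρ.exists_pos_of_mem (mem_univ x)
  have hif : i ∈ ρ.finsupport x := (ρ.mem_finsupport x).2 hi.ne'
  have h1 := (Finset.sum_eq_zero_iff_of_nonneg fun i _ =>
    mul_nonneg (ρ.nonneg i x) (sq_nonneg _)).1 h i hif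
  have h2 : fibCoord (χ i) (b x) w = 0 := by
    simpa [hi.ne'] using h1
  have h3 := (hχ i).fibInv_fibCoord (hs i (mem_tsupport_of_mem_finsupport hif)) w
  rw [h2, map_zero] at h3
  exact h3.symm

theorem contMDiffWithinAt_fibreSq [IsManifold 𝓘(ℝ, F) ∞ N] (hχ : ∀ i, IsSmoothChart (χ i))
    (hs : ∀ i, tsupport (ρ i) ⊆ b ⁻¹' (χ i).source) {p : Q → M} {w : Q → F} {s : Set Q} {q : Q}
    (hp : ContMDiffWithinAt J 𝓘(ℝ, E) ∞ p s q)
    (hw : ContMDiffWithinAt J 𝓘(ℝ, F).tangent ∞ (fun q => tangentMk (b (p q)) (w q)) s q) :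
    ContMDiffWithinAt J 𝓘(ℝ, ℝ) ∞ (fun q => fibreSq ρ b χ (p q) (w q)) s q := by
  refine contMDiffWithinAt_patch hp fun i hi => ?_
  have h := ((hχ i).contMDiffWithinAt_tangentMk_iff hw.of_tangentMk (hs i hi)).1 hw
  -- The square of the given norm of `F` need not be smooth, whereas that of a Euclidean norm is.
  have hn : ContDiff ℝ ∞ fun ξ : F => ‖toEuclidean ξ‖ ^ 2 :=
    (contDiff_norm_sq ℝ).comp (toEuclidean (E := F)).contDiff
  exact hn.contMDiff.contMDiffAt.comp_contMDiffWithinAt q h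

end FibreSq

section Control

variable [FiniteDimensional ℝ F]

/-- A positive homogeneous function of degree two controls neighbourhoods of zero. -/
theorem eventually_small_of_homogeneous {q : M × F → ℝ} {x₀ : M} {U : Set M} (hU : U ∈ 𝓝 x₀)
    (hc : ∀ x ∈ U, ∀ ξ, ContinuousAt q (x, ξ)) (hsmul : ∀ x t ξ, q (x, t • ξ) = t ^ 2 * q (x, ξ))
    (h0 : ∀ p, 0 ≤ q p) (hpos : ∀ x ∈ U, ∀ ξ, ξ ≠ 0 → q (x, ξ) ≠ 0)
    {D : Set (M × F)} (hD : D ∈ 𝓝 (x₀, (0 : F))) :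
    ∃ c : ℝ, 0 < c ∧ ∀ᶠ x in 𝓝 x₀, ∀ ξ, c * q (x, ξ) < 1 → (x, ξ) ∈ D := by
  obtain ⟨V, hV, R, hR, hVR⟩ := mem_nhds_prod_iff.1 hD
  obtain ⟨r, hr, hball⟩ := Metric.mem_nhds_iff.1 hR
  have hScomp : IsCompact (Metric.sphere (0 : F) (r / 2)) := isCompact_sphere _ _
  have hx₀ : x₀ ∈ U := mem_of_mem_nhds hU
  -- A positive lower bound on a sphere, later spread to nearby `x` by compactness. The sphere is
  -- empty when `F` is trivial.
  obtain ⟨δ, hδ, hδS⟩ : ∃ δ : ℝ, 0 < δ ∧ ∀ ξ ∈ Metric.sphere (0 : F) (r / 2), δ < q (x₀, ξ) := by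
    rcases (Metric.sphere (0 : F) (r / 2)).eq_empty_or_nonempty with he | hne
    · exact ⟨1, one_pos, by simp [he]⟩
    · have hcont : ContinuousOn (fun ξ => q (x₀, ξ)) (Metric.sphere (0 : F) (r / 2)) := fun ξ _ =>
        ((hc x₀ hx₀ ξ).comp (f := fun ξ : F => (x₀, ξ)) (by fun_prop)).continuousWithinAt
      obtain ⟨ξ₀, hξ₀, hmin⟩ := hScomp.exists_isMinOn hne hcont
      have hne0 : ξ₀ ≠ 0 := by
        rintro rfl
        simp only [mem_sphere_iff_norm, sub_self, norm_zero] at hξ₀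
        linarith
      have hq : 0 < q (x₀, ξ₀) := lt_of_le_of_ne (h0 _) (hpos x₀ hx₀ ξ₀ hne0).symm
      exact ⟨q (x₀, ξ₀) / 2, half_pos hq, fun ξ hξ => (half_lt_self hq).trans_le (hmin hξ)⟩
  have htube : ∀ᶠ x in 𝓝 x₀, ∀ ξ ∈ Metric.sphere (0 : F) (r / 2), δ < q (x, ξ) :=
    hScomp.eventually_forall_of_forall_eventually fun ξ hξ =>
      (hc x₀ hx₀ ξ).eventually (lt_mem_nhds (hδS ξ hξ))
  refine ⟨δ⁻¹, inv_pos.2 hδ, ?_⟩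
  filter_upwards [htube, hV] with x hx hxV ξ hξ
  refine hVR ⟨hxV, hball ?_⟩
  rw [mem_ball_zero_iff]
  by_contra hle
  push Not at hle
  have hξ0 : 0 < ‖ξ‖ := hr.trans_le hle
  -- A vector of norm at least `r` shrinks onto the sphere, so by homogeneity `q` exceeds `δ` there,
  -- against `δ⁻¹ * q < 1`.
  have h1 := hx ((r / 2 / ‖ξ‖) • ξ) (by
    rw [mem_sphere_zero_iff_norm, norm_smul, Real.norm_of_nonneg (by positivity)]
    field_simp)
  rw [hsmul] at h1
  have h2 : (r / 2 / ‖ξ‖) ^ 2 ≤ 1 := by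
    apply pow_le_one₀ (by positivity)
    rw [div_le_one hξ0]
    linarith
  have h3 : (r / 2 / ‖ξ‖) ^ 2 * q (x, ξ) ≤ q (x, ξ) := mul_le_of_le_one_left (h0 _) h2
  rw [inv_mul_lt_one₀ hδ] at hξ
  linarith

variable [FiniteDimensional ℝ E] [T2Space M] [ParacompactSpace M] [IsManifold 𝓘(ℝ, E) ∞ M]
  [IsManifold 𝓘(ℝ, F) ∞ N]

/-- Local constants `c i` are averaged by a partition of unity. If `l x * q x w < 1`, then `c i * q
x w < 1` for some `i` in the finite support at `x`, since a weighted mean of numbers at least `1` is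
at least `1`. -/
theorem exists_contMDiff_control (hb : ContMDiff 𝓘(ℝ, E) 𝓘(ℝ, F) ∞ b) {q : M → F → ℝ}
    (hq : ContMDiffOn (𝓘(ℝ, E).prod 𝓘(ℝ, F).tangent) 𝓘(ℝ, ℝ) ∞
      (fun u : M × TangentBundle 𝓘(ℝ, F) N => q u.1 u.2.snd) (pullbackTangent F b))
    (hsmul : ∀ x (t : ℝ) w, q x (t • w) = t ^ 2 * q x w) (h0 : ∀ x w, 0 ≤ q x w)
    (hpos : ∀ x w, q x w = 0 → w = 0) {D : Set (M × TangentBundle 𝓘(ℝ, F) N)}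
    (hD : ∀ x, D ∈ 𝓝[pullbackTangent F b]
      ((x, tangentMk (b x) 0) : M × TangentBundle 𝓘(ℝ, F) N)) :
    ∃ l : M → ℝ, ContMDiff 𝓘(ℝ, E) 𝓘(ℝ, ℝ) ∞ l ∧ (∀ x, 0 < l x) ∧
      ∀ x w, l x * q x w < 1 → ((x, tangentMk (b x) w) : M × TangentBundle 𝓘(ℝ, F) N) ∈ D := by
  have hloc : ∀ x₀ : M, ∃ c : ℝ, 0 < c ∧ ∀ᶠ x in 𝓝 x₀, ∀ w, c * q x w < 1 →
      ((x, tangentMk (b x) w) : M × TangentBundle 𝓘(ℝ, F) N) ∈ D := by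
    intro x₀
    set χ := chartAt F (b x₀)
    have hχ : IsSmoothChart χ := isSmoothChart_chartAt (b x₀)
    have hU : b ⁻¹' χ.source ∈ 𝓝 x₀ :=
      hb.continuous.continuousAt (χ.open_source.mem_nhds (mem_chart_source F (b x₀)))
    let g : M × F → M × TangentBundle 𝓘(ℝ, F) N := fun u =>
      (u.1, tangentMk (b u.1) (fibInv χ (b u.1) u.2))
    have hg : ∀ x ∈ b ⁻¹' χ.source, ∀ ξ, ContinuousAt g (x, ξ) := fun x hx ξ => by
      have h : ContMDiffAt (𝓘(ℝ, E).prod 𝓘(ℝ, F)) 𝓘(ℝ, F).tangent ∞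
          (fun u : M × F => tangentMk (b u.1) (fibInv χ (b u.1) u.2)) (x, ξ) :=
        hχ.contMDiffWithinAt_fibInv (hb.contMDiffAt.comp (x, ξ) contMDiffAt_fst)
          contMDiffAt_snd hx
      exact continuousAt_fst.prodMk h.continuousAt
    have hg' : ∀ x ∈ b ⁻¹' χ.source, ∀ ξ, Tendsto g (𝓝 (x, ξ)) (𝓝[pullbackTangent F b] g (x, ξ)) :=
      fun x hx ξ => tendsto_nhdsWithin_iff.2 ⟨hg x hx ξ, Eventually.of_forall fun u => rfl⟩
    have hg0 : g (x₀, 0) = (x₀, tangentMk (b x₀) 0) := by simp [g]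
    obtain ⟨c, hc, hcD⟩ := eventually_small_of_homogeneous
      (q := fun u : M × F => q u.1 (fibInv χ (b u.1) u.2)) (D := g ⁻¹' D) hU
      (fun x hx ξ => (hq.continuousOn (g (x, ξ)) rfl).tendsto.comp (hg' x hx ξ))
      (fun x t ξ => by simp only [map_smul, hsmul]) (fun _ => h0 _ _)
      (fun x hx ξ hξ h => hξ (by
        have h1 := hχ.fibCoord_fibInv hx ξ
        rw [hpos _ _ h, map_zero] at h1
        exact h1.symm))
      (hg' x₀ (mem_of_mem_nhds hU) 0 (by rw [hg0]; exact hD x₀))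
    refine ⟨c, hc, ?_⟩
    filter_upwards [hcD, hU] with x hx hxU w hw
    have h1 := hx (fibCoord χ (b x) w)
    simp only [hχ.fibInv_fibCoord hxU, g, mem_preimage] at h1
    exact h1 hw
  choose c hc hcD using hloc
  obtain ⟨ρ, hρ⟩ := exists_smoothPartitionOfUnity (E := E) _ hcD
  refine ⟨fun x => patch ρ x c, fun x => contMDiffWithinAt_patch (J := 𝓘(ℝ, E)) (s := univ)
    contMDiffWithinAt_id fun i _ => contMDiffWithinAt_const, fun x => ?_, fun x w h => ?_⟩
  · obtain ⟨i, hi⟩ := ρ.exists_pos_of_mem (mem_univ x)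
    exact Finset.sum_pos' (fun j _ => mul_nonneg (ρ.nonneg j x) (hc j).le)
      ⟨i, (ρ.mem_finsupport x).2 hi.ne', mul_pos hi (hc i)⟩
  · by_contra hD'
    have h1 : ∀ i ∈ ρ.finsupport x, ρ i x ≤ ρ i x • c i * q x w := fun i hi => by
      have h2 : 1 ≤ c i * q x w := by
        by_contra h3
        push Not at h3
        exact hD' (hρ i (mem_tsupport_of_mem_finsupport hi) w h3)
      rw [smul_eq_mul, mul_assoc]
      exact le_mul_of_one_le_right (ρ.nonneg i x) h2
    have h2 := Finset.sum_le_sum h1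
    rw [ρ.sum_finsupport x (mem_univ x), ← Finset.sum_mul] at h2
    exact absurd h (not_lt.2 h2)

end Control

end FibreNorms

/-! ### Contracting the bundle onto a polydisc bundle. -/

section Contraction

open Topology Filter

variable {E : Type*} [NormedAddCommGroup E] [NormedSpace ℝ E]
  {F : Type*} [NormedAddCommGroup F] [NormedSpace ℝ F]
  {M : Type*} [TopologicalSpace M] [ChartedSpace E M]
  {N : Type*} [TopologicalSpace N] [ChartedSpace F N] [IsManifold 𝓘(ℝ, F) ∞ N]

variable (E) in
/-- A splitting of the fibres of `b^* TN` by projections `P`, with smooth functions `q₁` and `q₂`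
that are homogeneous of degree two in the two components. -/
structure FibreSplitting (b : M → N) (P : M → F →L[ℝ] F) (q₁ q₂ : M → F → ℝ) : Prop where
  smooth_proj : ContMDiffOn (𝓘(ℝ, E).prod 𝓘(ℝ, F).tangent) 𝓘(ℝ, F).tangent ∞
    (fun u : M × TangentBundle 𝓘(ℝ, F) N => tangentMk u.2.proj (P u.1 u.2.snd))
    (pullbackTangent F b)
  smooth_left : ContMDiffOn (𝓘(ℝ, E).prod 𝓘(ℝ, F).tangent) 𝓘(ℝ, ℝ) ∞
    (fun u : M × TangentBundle 𝓘(ℝ, F) N => q₁ u.1 u.2.snd) (pullbackTangent F b)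
  smooth_right : ContMDiffOn (𝓘(ℝ, E).prod 𝓘(ℝ, F).tangent) 𝓘(ℝ, ℝ) ∞
    (fun u : M × TangentBundle 𝓘(ℝ, F) N => q₂ u.1 u.2.snd) (pullbackTangent F b)
  proj_proj : ∀ x w, P x (P x w) = P x w
  nonneg_left : ∀ x w, 0 ≤ q₁ x w
  nonneg_right : ∀ x w, 0 ≤ q₂ x w
  left_smul : ∀ x (s t : ℝ) w, q₁ x (s • (w - P x w) + t • P x w) = s ^ 2 * q₁ x w
  right_smul : ∀ x (s t : ℝ) w, q₂ x (s • (w - P x w) + t • P x w) = t ^ 2 * q₂ x w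

/-- The two components of `w` rescaled by `(1 + ε l q₁)^{-1/2}` and `(1 + ε l q₂)^{-1/2}`. -/
noncomputable def fibreScale (P : M → F →L[ℝ] F) (q₁ q₂ : M → F → ℝ) (l : M → ℝ) (ε : ℝ)
    (x : M) (w : F) : F :=
  (√(1 + ε * (l x * q₁ x w)))⁻¹ • (w - P x w) + (√(1 + ε * (l x * q₂ x w)))⁻¹ • P x w

theorem fibreScale_zero {M : Type*} {P : M → F →L[ℝ] F} {q₁ q₂ : M → F → ℝ} {l : M → ℝ} {ε : ℝ} (x : M) :
    fibreScale P q₁ q₂ l ε x 0 = 0 := by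
  simp [fibreScale]

/-- The open polydisc bundle onto which `fibreScale` with `ε = 1` maps. -/
def fibreDisc (q₁ q₂ : M → F → ℝ) (l : M → ℝ) : Set (M × F) :=
  {u | l u.1 * q₁ u.1 u.2 < 1 ∧ l u.1 * q₂ u.1 u.2 < 1}

namespace FibreSplitting

variable {b : M → N} {P : M → F →L[ℝ] F} {q₁ q₂ : M → F → ℝ} {l : M → ℝ}

theorem left_smul_self (h : FibreSplitting E b P q₁ q₂) (x : M) (t : ℝ) (w : F) :
    q₁ x (t • w) = t ^ 2 * q₁ x w := by
  have := h.left_smul x t t w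
  rwa [← smul_add, sub_add_cancel] at this

theorem right_smul_self (h : FibreSplitting E b P q₁ q₂) (x : M) (t : ℝ) (w : F) :
    q₂ x (t • w) = t ^ 2 * q₂ x w := by
  have := h.right_smul x t t w
  rwa [← smul_add, sub_add_cancel] at this

/-- Rescaling by `ε` and then by `-ε` is the identity. -/
theorem fibreScale_fibreScale (h : FibreSplitting E b P q₁ q₂) {ε : ℝ} {x : M} {w : F}
    (h1 : 0 < 1 + ε * (l x * q₁ x w)) (h2 : 0 < 1 + ε * (l x * q₂ x w)) :
    fibreScale P q₁ q₂ l (-ε) x (fibreScale P q₁ q₂ l ε x w) = w := by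
  -- With `s = (1 + ε r)^{-1/2}` one has `1 - ε s² r = (1 + ε r)⁻¹`, so the second scaling factor is
  -- `s⁻¹`.
  have key : ∀ r : ℝ, 0 < 1 + ε * r →
      (√(1 + -ε * ((√(1 + ε * r))⁻¹ ^ 2 * r)))⁻¹ * (√(1 + ε * r))⁻¹ = 1 := by
    intro r hr
    have h3 : 1 + -ε * ((√(1 + ε * r))⁻¹ ^ 2 * r) = (1 + ε * r)⁻¹ := by
      rw [inv_pow, Real.sq_sqrt hr.le]
      field_simp
      ring
    rw [h3, Real.sqrt_inv, inv_inv, mul_inv_cancel₀ (Real.sqrt_pos.2 hr).ne']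
  set s := (√(1 + ε * (l x * q₁ x w)))⁻¹ with hs
  set t := (√(1 + ε * (l x * q₂ x w)))⁻¹ with ht
  have hw : fibreScale P q₁ q₂ l ε x w = s • (w - P x w) + t • P x w := rfl
  have hP : P x (s • (w - P x w) + t • P x w) = t • P x w := by
    simp [map_add, map_smul, map_sub, h.proj_proj]
  rw [hw, fibreScale, hP, h.left_smul, h.right_smul, add_sub_cancel_right, smul_smul, smul_smul]
  have k1 := key _ h1
  have k2 := key _ h2
  rw [← hs] at k1
  rw [← ht] at k2
  rw [show l x * (s ^ 2 * q₁ x w) = s ^ 2 * (l x * q₁ x w) by ring,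
    show l x * (t ^ 2 * q₂ x w) = t ^ 2 * (l x * q₂ x w) by ring, k1, k2, one_smul, one_smul,
    sub_add_cancel]

theorem one_add_pos (h : FibreSplitting E b P q₁ q₂) (hl : ∀ x, 0 < l x) (x : M) (w : F) :
    0 < 1 + 1 * (l x * q₁ x w) ∧ 0 < 1 + 1 * (l x * q₂ x w) := by
  have h1 := mul_nonneg (hl x).le (h.nonneg_left x w)
  have h2 := mul_nonneg (hl x).le (h.nonneg_right x w)
  constructor <;> linarith

/-- Each quantity `r = l q` becomes `r / (1 + r) < 1`. -/
theorem fibreScale_mem_fibreDisc (h : FibreSplitting E b P q₁ q₂) (hl : ∀ x, 0 < l x) (x : M)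
    (w : F) : (x, fibreScale P q₁ q₂ l 1 x w) ∈ fibreDisc q₁ q₂ l := by
  obtain ⟨h1, h2⟩ := h.one_add_pos hl x w
  have key : ∀ r : ℝ, 0 < 1 + 1 * r → (√(1 + 1 * r))⁻¹ ^ 2 * r < 1 := by
    intro r hr
    rw [inv_pow, Real.sq_sqrt hr.le, inv_mul_lt_one₀ hr]
    linarith
  have k1 := key _ h1
  have k2 := key _ h2
  constructor
  · simp only [fibreScale, h.left_smul]
    linarith
  · simp only [fibreScale, h.right_smul]
    linarith

theorem contMDiffWithinAt_fibreScale (h : FibreSplitting E b P q₁ q₂)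
    (hl : ContMDiff 𝓘(ℝ, E) 𝓘(ℝ, ℝ) ∞ l) {ε : ℝ} {u : M × TangentBundle 𝓘(ℝ, F) N}
    (hu : u ∈ pullbackTangent F b) (h1 : 0 < 1 + ε * (l u.1 * q₁ u.1 u.2.snd))
    (h2 : 0 < 1 + ε * (l u.1 * q₂ u.1 u.2.snd)) :
    ContMDiffWithinAt (𝓘(ℝ, E).prod 𝓘(ℝ, F).tangent) 𝓘(ℝ, F).tangent ∞
      (fun u : M × TangentBundle 𝓘(ℝ, F) N =>
        tangentMk u.2.proj (fibreScale P q₁ q₂ l ε u.1 u.2.snd)) (pullbackTangent F b) u := by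
  let vec : M × TangentBundle 𝓘(ℝ, F) N → F := fun u => u.2.snd
  have hid : ContMDiffWithinAt (𝓘(ℝ, E).prod 𝓘(ℝ, F).tangent) 𝓘(ℝ, F).tangent ∞
      (fun u : M × TangentBundle 𝓘(ℝ, F) N => tangentMk u.2.proj (vec u))
      (pullbackTangent F b) u := contMDiffWithinAt_snd
  have hP := h.smooth_proj u hu
  have hlu : ContMDiffWithinAt (𝓘(ℝ, E).prod 𝓘(ℝ, F).tangent) 𝓘(ℝ, ℝ) ∞
      (fun u : M × TangentBundle 𝓘(ℝ, F) N => l u.1) (pullbackTangent F b) u :=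
    hl.contMDiffAt.comp_contMDiffWithinAt u contMDiffWithinAt_fst
  have hscale : ∀ g : M × TangentBundle 𝓘(ℝ, F) N → ℝ,
      ContMDiffWithinAt (𝓘(ℝ, E).prod 𝓘(ℝ, F).tangent) 𝓘(ℝ, ℝ) ∞ g (pullbackTangent F b) u →
      0 < 1 + ε * (l u.1 * g u) →
      ContMDiffWithinAt (𝓘(ℝ, E).prod 𝓘(ℝ, F).tangent) 𝓘(ℝ, ℝ) ∞
        (fun u => (√(1 + ε * (l u.1 * g u)))⁻¹) (pullbackTangent F b) u := by
    intro g hg hpos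
    have hs : ContDiffAt ℝ ∞ (fun r : ℝ => (√(1 + ε * r))⁻¹) (l u.1 * g u) := by
      refine ContDiffAt.inv (ContDiffAt.sqrt (by fun_prop) hpos.ne') (Real.sqrt_pos.2 hpos).ne'
    have hlg : ContMDiffWithinAt (𝓘(ℝ, E).prod 𝓘(ℝ, F).tangent) 𝓘(ℝ, ℝ) ∞
        (fun u => l u.1 * g u) (pullbackTangent F b) u := hlu.mul hg
    exact ContMDiffAt.comp_contMDiffWithinAt (g := fun r : ℝ => (√(1 + ε * r))⁻¹) u hs.contMDiffAt hlg
  have hsub : ContMDiffWithinAt (𝓘(ℝ, E).prod 𝓘(ℝ, F).tangent) 𝓘(ℝ, F).tangent ∞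
      (fun u : M × TangentBundle 𝓘(ℝ, F) N =>
        tangentMk u.2.proj (vec u + (-1 : ℝ) • P u.1 (vec u))) (pullbackTangent F b) u :=
    hid.tangentMk_add (ContMDiffWithinAt.tangentMk_smul contMDiffWithinAt_const hP)
  have := (ContMDiffWithinAt.tangentMk_smul (hscale _ (h.smooth_left u hu) h1) hsub).tangentMk_add
    (ContMDiffWithinAt.tangentMk_smul (hscale _ (h.smooth_right u hu) h2) hP)
  have heq : ∀ u : M × TangentBundle 𝓘(ℝ, F) N, fibreScale P q₁ q₂ l ε u.1 (vec u) =
      (√(1 + ε * (l u.1 * q₁ u.1 (vec u))))⁻¹ • (vec u + (-1 : ℝ) • P u.1 (vec u)) +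
        (√(1 + ε * (l u.1 * q₂ u.1 (vec u))))⁻¹ • P u.1 (vec u) := fun u => by
    rw [fibreScale, neg_smul, one_smul, sub_eq_add_neg]
  exact this.congr (fun u _ => congrArg (tangentMk u.2.proj) (heq u))
    (congrArg (tangentMk u.2.proj) (heq u))

/-- By homogeneity each component is `t (1 + ε l t² r)^{-1/2}` times a fixed vector, and this scalar
has derivative `1` at `0`. -/
theorem hasDerivAt_fibreScale (h : FibreSplitting E b P q₁ q₂) {ε : ℝ} (x : M) (w : F) :
    HasDerivAt (fun t : ℝ => fibreScale P q₁ q₂ l ε x (t • w)) w 0 := by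
  have hscale : ∀ r : ℝ, HasDerivAt (fun t : ℝ => (√(1 + ε * (l x * (t ^ 2 * r))))⁻¹ * t) 1 0 := by
    intro r
    have h1 : HasDerivAt (fun t : ℝ => 1 + ε * (l x * (t ^ 2 * r))) 0 0 := by
      simpa using ((((hasDerivAt_pow 2 (0 : ℝ)).mul_const r).const_mul (l x)).const_mul ε).const_add
        1
    have h2 := ((h1.sqrt (by simp)).inv (by simp)).mul (hasDerivAt_id (0 : ℝ))
    refine (h2.congr_deriv ?_).congr_of_eventuallyEq (Eventually.of_forall fun t => rfl)
    simp
  have h1 := ((hscale (q₁ x w)).smul_const (w - P x w)).add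
    ((hscale (q₂ x w)).smul_const (P x w))
  rw [one_smul, one_smul, sub_add_cancel] at h1
  refine h1.congr_of_eventuallyEq (Eventually.of_forall fun t => ?_)
  simp only [fibreScale, h.left_smul_self, h.right_smul_self, map_smul, ← smul_sub, smul_smul,
    Pi.add_apply]

end FibreSplitting

end Contraction

/-! ### From a linearization to a kinematic deflation. -/

section Linearization

open Topology Filter

variable {E : Type*} [NormedAddCommGroup E] [NormedSpace ℝ E]
  {F : Type*} [NormedAddCommGroup F] [NormedSpace ℝ F]
  {M : Type*} [TopologicalSpace M] [ChartedSpace E M]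
  {N : Type*} [TopologicalSpace N] [ChartedSpace F N] [IsManifold 𝓘(ℝ, F) ∞ N]

variable (E) in
/-- A fibrewise diffeomorphism `ν` from `b^* TN` onto an open neighbourhood `V` of the graph of `b`,
with inverse `Λ`, whose derivative along the zero section is the identity. -/
structure FibreLinearization (b : M → N) (V : Set (M × N)) (ν : M → F → N) (Λ : M → N → F) :
    Prop where
  isOpen : IsOpen V
  mem : ∀ x w, (x, ν x w) ∈ V
  smooth : ContMDiffOn (𝓘(ℝ, E).prod 𝓘(ℝ, F).tangent) 𝓘(ℝ, F) ∞
    (fun u : M × TangentBundle 𝓘(ℝ, F) N => ν u.1 u.2.snd) (pullbackTangent F b)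
  smooth_inv : ContMDiffOn (𝓘(ℝ, E).prod 𝓘(ℝ, F)) 𝓘(ℝ, F).tangent ∞
    (fun p : M × N => tangentMk (b p.1) (Λ p.1 p.2)) V
  left_inv : ∀ x w, Λ x (ν x w) = w
  right_inv : ∀ p ∈ V, ν p.1 (Λ p.1 p.2) = p.2
  zero : ∀ x, ν x 0 = b x
  deriv : ∀ x w, HasMFDerivAt 𝓘(ℝ, ℝ) 𝓘(ℝ, F) (fun t : ℝ => ν x (t • w)) 0
    (ContinuousLinearMap.toSpanSingleton ℝ w)

theorem contMDiffWithinAt_verticalLift [IsManifold 𝓘(ℝ, E) ∞ M] {G : Type*} [NormedAddCommGroup G] [NormedSpace ℝ G]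
    {K : Type*} [TopologicalSpace K] {J : ModelWithCorners ℝ G K} {Q : Type*} [TopologicalSpace Q]
    [ChartedSpace K Q] {p : Q → M} {w : Q → TangentBundle 𝓘(ℝ, F) N} {s : Set Q} {q : Q}
    (hp : ContMDiffWithinAt J 𝓘(ℝ, E) ∞ p s q)
    (hw : ContMDiffWithinAt J 𝓘(ℝ, F).tangent ∞ w s q) :
    ContMDiffWithinAt J (𝓘(ℝ, E).prod 𝓘(ℝ, F)).tangent ∞
      (fun q => verticalLift (E := E) (p q) (w q)) s q := by
  have h0 : ContMDiffWithinAt J 𝓘(ℝ, E).tangent ∞ (fun q => tangentMk (p q) (0 : E)) s q := by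
    have h1 := (isSmoothChart_chartAt (F := E) (p q)).contMDiffWithinAt_fibInv
      (ξ := fun _ => (0 : E)) hp contMDiffWithinAt_const (mem_chart_source E (p q))
    simpa using h1
  exact (contMDiff_equivTangentBundleProd_symm (n := ∞)).contMDiffAt.comp_contMDiffWithinAt q
    (h0.prodMk hw)

namespace FibreLinearization

variable {b : M → N} {V : Set (M × N)} {ν : M → F → N} {Λ : M → N → F}

theorem graph_mem (h : FibreLinearization E b V ν Λ) (x : M) : (x, b x) ∈ V := by
  rw [← h.zero x]; exact h.mem x 0

theorem isDiffeoOn (h : FibreLinearization E b V ν Λ) :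
    IsDiffeoOn (𝓘(ℝ, E).prod 𝓘(ℝ, F).tangent) (𝓘(ℝ, E).prod 𝓘(ℝ, F))
      (fun u : M × TangentBundle 𝓘(ℝ, F) N => (u.1, ν u.1 u.2.snd)) (pullbackTangent F b) V := by
  refine ⟨fun u _ => h.mem _ _, contMDiffOn_fst.prodMk h.smooth,
    fun p => (p.1, tangentMk (b p.1) (Λ p.1 p.2)), fun p _ => rfl,
    contMDiffOn_fst.prodMk h.smooth_inv, ?_, ?_⟩
  · rintro ⟨x, ⟨y, w⟩⟩ hu
    have hy : y = b x := hu
    subst hy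
    exact congrArg (fun w => (x, tangentMk (b x) w)) (h.left_inv x w)
  · rintro p hp
    simp only [h.right_inv p hp]

theorem velocity_eq (h : FibreLinearization E b V ν Λ) (x : M) (w : F) :
    velocity (𝓘(ℝ, E).prod 𝓘(ℝ, F)) (fun t : ℝ => (x, ν x (t • w))) =
      verticalLift (E := E) x (tangentMk (b x) w) := by
  have h1 := (hasMFDerivAt_const (I := 𝓘(ℝ, ℝ)) (I' := 𝓘(ℝ, E)) x (0 : ℝ)).prodMk (h.deriv x w)
  have h2 : mfderiv 𝓘(ℝ, ℝ) (𝓘(ℝ, E).prod 𝓘(ℝ, F)) (fun t : ℝ => (x, ν x (t • w))) 0 (1 : ℝ) =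
      ((0 : E), w) := by
    rw [h1.mfderiv]
    exact Prod.ext rfl (one_smul ℝ w)
  have h3 : ν x ((0 : ℝ) • w) = b x := by rw [zero_smul, h.zero]
  -- The base points `ν x (0 • w)` and `b x` agree only propositionally, so the base point is
  -- generalized.
  have h4 : ∀ y, ν x ((0 : ℝ) • w) = y →
      velocity (𝓘(ℝ, E).prod 𝓘(ℝ, F)) (fun t : ℝ => (x, ν x (t • w))) =
        verticalLift (E := E) x (tangentMk y w) := by
    rintro y rfl
    rw [velocity, h2]
    rfl
  exact h4 _ h3

/-- The deflation of the graph of `b` induced by a linearization. -/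
def deflation (h : FibreLinearization E b V ν Λ) (hb : ContMDiff 𝓘(ℝ, E) 𝓘(ℝ, F) ∞ b)
    {X Y : Set (M × N)} (hX : ∀ p : M × N, p ∈ X ↔ p.2 = b p.1) (hXY : X ⊆ Y)
    (hY : ∀ p ∈ Y ∩ V, ∀ t : ℝ, (p.1, ν p.1 (t • Λ p.1 p.2)) ∈ Y) :
    SmoothLocalDeflation (𝓘(ℝ, E).prod 𝓘(ℝ, F)) X Y where
  V := Y ∩ V
  τ p := (p.1, b p.1)
  isOpen_in := ⟨V, h.isOpen, rfl⟩
  subset := fun p hp => ⟨hXY hp, by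
    have : p = (p.1, b p.1) := Prod.ext rfl ((hX p).1 hp)
    rw [this]; exact h.graph_mem _⟩
  smooth_τ := (contMDiff_fst.prodMk (hb.comp contMDiff_fst)).contMDiffOn
  mapsTo_τ := fun p _ => (hX _).2 rfl
  τ_eq_self := fun p hp => Prod.ext rfl ((hX p).1 hp).symm
  H t p := (p.1, ν p.1 (t • Λ p.1 p.2))
  mapsTo_H := fun t p hp => ⟨hY p hp t, h.mem _ _⟩
  smooth_H := by
    have h1 : ContMDiffOn (𝓘(ℝ, ℝ).prod (𝓘(ℝ, E).prod 𝓘(ℝ, F))) 𝓘(ℝ, E) ∞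
        (fun q : ℝ × (M × N) => q.2.1) (univ ×ˢ (Y ∩ V)) :=
      (contMDiff_fst.comp contMDiff_snd).contMDiffOn
    have h2 : ContMDiffOn (𝓘(ℝ, ℝ).prod (𝓘(ℝ, E).prod 𝓘(ℝ, F))) 𝓘(ℝ, F).tangent ∞
        (fun q : ℝ × (M × N) => tangentMk (b q.2.1) (Λ q.2.1 q.2.2)) (univ ×ˢ (Y ∩ V)) :=
      h.smooth_inv.comp contMDiffOn_snd fun q hq => hq.2.2
    have h3 : ContMDiffOn (𝓘(ℝ, ℝ).prod (𝓘(ℝ, E).prod 𝓘(ℝ, F))) 𝓘(ℝ, F).tangent ∞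
        (fun q : ℝ × (M × N) => tangentMk (b q.2.1) (q.1 • Λ q.2.1 q.2.2)) (univ ×ˢ (Y ∩ V)) :=
      fun q hq => ContMDiffWithinAt.tangentMk_smul contMDiffWithinAt_fst (h2 q hq)
    exact h1.prodMk (h.smooth.comp (h1.prodMk h3) fun q _ => rfl)
  τ_H := fun t p _ => rfl
  H_H := fun s t p _ => by simp only [h.left_inv, smul_smul]
  H_one := fun p hp => by simp only [one_smul, h.right_inv p hp.2]
  H_zero := fun p _ => by simp only [zero_smul, h.zero]

variable (h : FibreLinearization E b V ν Λ) (hb : ContMDiff 𝓘(ℝ, E) 𝓘(ℝ, F) ∞ b)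
    {X Y : Set (M × N)} (hX : ∀ p : M × N, p ∈ X ↔ p.2 = b p.1) (hXY : X ⊆ Y)
    (hY : ∀ p ∈ Y ∩ V, ∀ t : ℝ, (p.1, ν p.1 (t • Λ p.1 p.2)) ∈ Y)

theorem kinematicMap_deflation (p : M × N) :
    (h.deflation hb hX hXY hY).kinematicMap p =
      verticalLift (E := E) p.1 (tangentMk (b p.1) (Λ p.1 p.2)) :=
  h.velocity_eq p.1 (Λ p.1 p.2)

theorem kinematicMap_deflation_apply (x : M) (w : F) :
    (h.deflation hb hX hXY hY).kinematicMap (x, ν x w) =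
      verticalLift (E := E) x (tangentMk (b x) w) := by
  rw [kinematicMap_deflation, h.left_inv]

theorem toSpanSingleton_apply_one {A : Type*} [NormedAddCommGroup A] [NormedSpace ℝ A]
    (L : ℝ →L[ℝ] A) : ContinuousLinearMap.toSpanSingleton ℝ (L 1) = L := by
  ext
  simp

/-- Since `τ p = (p.1, b p.1)`, a vector annihilated by `Tτ` has vanishing first component, hence is
vertical. -/
theorem velocity_of_mem_kerTangent {γ : ℝ → M × N}
    (hγ : ContMDiff 𝓘(ℝ, ℝ) (𝓘(ℝ, E).prod 𝓘(ℝ, F)) ∞ γ) (h0 : γ 0 ∈ X)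
    (hτ : velocity (𝓘(ℝ, E).prod 𝓘(ℝ, F)) ((h.deflation hb hX hXY hY).τ ∘ γ) =
      ⟨(h.deflation hb hX hXY hY).τ (γ 0), 0⟩) :
    ∃ w : F, (γ 0).2 = b (γ 0).1 ∧
      HasMFDerivAt 𝓘(ℝ, ℝ) 𝓘(ℝ, E) (fun t => (γ t).1) 0
        (ContinuousLinearMap.toSpanSingleton ℝ (0 : E)) ∧
      HasMFDerivAt 𝓘(ℝ, ℝ) 𝓘(ℝ, F) (fun t => (γ t).2) 0
        (ContinuousLinearMap.toSpanSingleton ℝ w) ∧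
      velocity (𝓘(ℝ, E).prod 𝓘(ℝ, F)) γ =
        verticalLift (E := E) (γ 0).1 (tangentMk (b (γ 0).1) w) := by
  have hd1 : MDifferentiableAt 𝓘(ℝ, ℝ) 𝓘(ℝ, E) (fun t => (γ t).1) 0 :=
    (contMDiff_fst.comp hγ).mdifferentiableAt (by simp)
  have hd2 : MDifferentiableAt 𝓘(ℝ, ℝ) 𝓘(ℝ, F) (fun t => (γ t).2) 0 :=
    (contMDiff_snd.comp hγ).mdifferentiableAt (by simp)
  have hdb : MDifferentiableAt 𝓘(ℝ, ℝ) 𝓘(ℝ, F) (fun t => b (γ t).1) 0 :=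
    (hb.comp (contMDiff_fst.comp hγ)).mdifferentiableAt (by simp)
  let L1 : ℝ →L[ℝ] E := mfderiv 𝓘(ℝ, ℝ) 𝓘(ℝ, E) (fun t => (γ t).1) 0
  let L2 : ℝ →L[ℝ] F := mfderiv 𝓘(ℝ, ℝ) 𝓘(ℝ, F) (fun t => (γ t).2) 0
  have hL1 : L1 1 = 0 := by
    have h1 := (hd1.hasMFDerivAt.prodMk hdb.hasMFDerivAt).mfderiv
    have h2 : mfderiv 𝓘(ℝ, ℝ) (𝓘(ℝ, E).prod 𝓘(ℝ, F))
        ((h.deflation hb hX hXY hY).τ ∘ γ) 0 (1 : ℝ) = (0 : E × F) :=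
      Bundle.TotalSpace.mk_inj.1 hτ
    have h3 := DFunLike.congr_fun h1 (1 : ℝ)
    exact congrArg Prod.fst (h3.symm.trans h2)
  have hγ2 : (γ 0).2 = b (γ 0).1 := (hX _).1 h0
  refine ⟨L2 1, hγ2, ?_, ?_, ?_⟩
  · refine hd1.hasMFDerivAt.congr_mfderiv ?_
    rw [← hL1]
    exact (toSpanSingleton_apply_one L1).symm
  · exact hd2.hasMFDerivAt.congr_mfderiv (toSpanSingleton_apply_one L2).symm
  · have h2 : mfderiv 𝓘(ℝ, ℝ) (𝓘(ℝ, E).prod 𝓘(ℝ, F)) γ 0 (1 : ℝ) = ((0 : E), L2 1) := by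
      have h1 := (hd1.hasMFDerivAt.prodMk hd2.hasMFDerivAt).mfderiv
      have h3 := DFunLike.congr_fun h1 (1 : ℝ)
      refine h3.trans (Prod.ext hL1 rfl)
    rw [velocity, h2, ← hγ2]
    rfl

/-- The inverse of the kinematic map sends the vertical vector `w` at `x` to `(x, ν x w)`.
Hypothesis `hK` ensures that vertical vectors tangent to `Y` are sent into `Y`; it is vacuous for `Y
= univ` and is proved for `K_f` by differentiation. -/
theorem deflation_isKinematic [IsManifold 𝓘(ℝ, E) ∞ M]
    (hK : ∀ (γ : ℝ → M × N) (w : F), (∀ t, γ t ∈ Y) → (γ 0).2 = b (γ 0).1 →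
      HasMFDerivAt 𝓘(ℝ, ℝ) 𝓘(ℝ, E) (fun t => (γ t).1) 0
        (ContinuousLinearMap.toSpanSingleton ℝ (0 : E)) →
      HasMFDerivAt 𝓘(ℝ, ℝ) 𝓘(ℝ, F) (fun t => (γ t).2) 0
        (ContinuousLinearMap.toSpanSingleton ℝ w) → ((γ 0).1, ν (γ 0).1 w) ∈ Y) :
    (h.deflation hb hX hXY hY).IsKinematic := by
  set S := h.deflation hb hX hXY hY with hS
  have hker : ∀ u ∈ S.kerTangent, ∃ x w, u = verticalLift (E := E) x (tangentMk (b x) w) ∧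
      (x, ν x w) ∈ Y := by
    rintro u ⟨γ, hγ, hγV, h0, hu, hτ⟩
    obtain ⟨w, h1, h2, h3, h4⟩ := h.velocity_of_mem_kerTangent hb hX hXY hY hγ h0 hτ
    exact ⟨(γ 0).1, w, hu.symm.trans h4, hK γ w (fun t => (hγV t).1) h1 h2 h3⟩
  refine ⟨?_, ?_, fun u => (u.proj.1, ν u.proj.1 u.snd.2), ?_, ?_, ?_, ?_⟩
  · intro p hp
    -- The orbit of `p` itself represents its kinematic vector; `τ` is constant along it.
    refine ⟨fun t => S.H t p, ?_, fun t => S.mapsTo_H t hp, ?_, rfl, ?_⟩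
    · exact contMDiffOn_univ.1 (S.smooth_H.comp (contMDiff_id.prodMk contMDiff_const).contMDiffOn
        fun t _ => ⟨mem_univ _, hp⟩)
    · change S.H 0 p ∈ X
      rw [S.H_zero p hp]
      exact S.mapsTo_τ hp
    · have h1 : (S.τ ∘ fun t => S.H t p) = fun _ => (p.1, b p.1) := rfl
      have h2 : mfderiv 𝓘(ℝ, ℝ) (𝓘(ℝ, E).prod 𝓘(ℝ, F)) (S.τ ∘ fun t => S.H t p) 0 (1 : ℝ) =
          (0 : E × F) := by
        rw [h1, mfderiv_const]; rfl
      rw [velocity, h2]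
      rfl
  · intro p hp
    have h1 := contMDiffWithinAt_verticalLift (E := E) (contMDiffWithinAt_fst (I := 𝓘(ℝ, E))
      (J := 𝓘(ℝ, F)) (s := Y ∩ V) (p := p)) ((h.smooth_inv p hp.2).mono inter_subset_right)
    exact h1.congr (fun p' _ => h.kinematicMap_deflation hb hX hXY hY p')
      (h.kinematicMap_deflation hb hX hXY hY p)
  · intro u hu
    obtain ⟨x, w, rfl, hxw⟩ := hker u hu
    exact ⟨hxw, h.mem x w⟩
  · have h1 : ContMDiffOn (𝓘(ℝ, E).prod 𝓘(ℝ, F)).tangent (𝓘(ℝ, E).prod 𝓘(ℝ, F).tangent) ∞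
        (fun u : TangentBundle (𝓘(ℝ, E).prod 𝓘(ℝ, F)) (M × N) =>
          (u.proj.1, (equivTangentBundleProd 𝓘(ℝ, E) M 𝓘(ℝ, F) N u).2)) S.kerTangent :=
      ((contMDiff_fst.comp (Bundle.contMDiff_proj _)).prodMk
        (contMDiff_snd.comp contMDiff_equivTangentBundleProd)).contMDiffOn
    refine ((contMDiff_fst.comp (Bundle.contMDiff_proj _)).contMDiffOn).prodMk
      (h.smooth.comp h1 fun u hu => ?_)
    obtain ⟨x, w, rfl, hxw⟩ := hker u hu
    rfl
  · intro p hp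
    rw [hS, h.kinematicMap_deflation hb hX hXY hY p]
    exact Prod.ext rfl (h.right_inv p hp.2)
  · intro u hu
    obtain ⟨x, w, rfl, hxw⟩ := hker u hu
    exact h.kinematicMap_deflation_apply hb hX hXY hY x w

end FibreLinearization

end Linearization

/-! ### Linearizations from inverted logarithms. -/

section ExistsLinearization

open Topology Filter

variable {E : Type*} [NormedAddCommGroup E] [NormedSpace ℝ E]
  {F : Type*} [NormedAddCommGroup F] [NormedSpace ℝ F]
  {M : Type*} [TopologicalSpace M] [ChartedSpace E M]
  {N : Type*} [TopologicalSpace N] [ChartedSpace F N] [IsManifold 𝓘(ℝ, F) ∞ N]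
  {b : M → N} {ψ : M → N → F} {W : Set (M × N)} {e : M → F → N}

/-- As `ψ` vanishes on the graph, right invertibility near its image there holds near the zero
section. This is the neighbourhood to be fed to `exists_contMDiff_control`. -/
theorem FibrewiseInverse.mem_nhdsWithin_zero (h : FibrewiseInverse E b ψ W e)
    (h0 : ∀ x, ψ x (b x) = 0) (x : M) :
    {u : M × TangentBundle 𝓘(ℝ, F) N | (u.1, e u.1 u.2.snd) ∈ W ∧
      ψ u.1 (e u.1 u.2.snd) = u.2.snd} ∈ 𝓝[pullbackTangent F b]
        ((x, tangentMk (b x) 0) : M × TangentBundle 𝓘(ℝ, F) N) := by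
  have := (h.local_right_inv _ (h.graph_mem x)).2
  simp only [h0] at this
  exact this

/-- Composing a fibrewise inverse with a fibrewise contraction yields a linearization. -/
theorem FibrewiseInverse.fibreLinearization (h : FibrewiseInverse E b ψ W e)
    (h0 : ∀ x, ψ x (b x) = 0)
    (hψ : ∀ x, HasMFDerivAt 𝓘(ℝ, F) 𝓘(ℝ, F) (ψ x) (b x) (ContinuousLinearMap.id ℝ F))
    {P : M → F →L[ℝ] F} {q₁ q₂ : M → F → ℝ} {l : M → ℝ} (hs : FibreSplitting E b P q₁ q₂)
    (hl : ContMDiff 𝓘(ℝ, E) 𝓘(ℝ, ℝ) ∞ l) (hpos : ∀ x, 0 < l x)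
    (hd : ∀ x w, (x, w) ∈ fibreDisc q₁ q₂ l → (x, e x w) ∈ W ∧ ψ x (e x w) = w) :
    FibreLinearization E b {p | p ∈ W ∧ (p.1, ψ p.1 p.2) ∈ fibreDisc q₁ q₂ l}
      (fun x w => e x (fibreScale P q₁ q₂ l 1 x w))
      (fun x z => fibreScale P q₁ q₂ l (-1) x (ψ x z)) := by
  have hWψ : ContMDiffOn (𝓘(ℝ, E).prod 𝓘(ℝ, F)) (𝓘(ℝ, E).prod 𝓘(ℝ, F).tangent) ∞
      (fun p : M × N => (p.1, tangentMk (b p.1) (ψ p.1 p.2))) W :=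
    contMDiffOn_fst.prodMk fun p hp => (h.smooth p hp).contMDiffWithinAt
  have hmem := fun x w => hd x _ (hs.fibreScale_mem_fibreDisc hpos x w)
  have hsmooth : ContMDiffOn (𝓘(ℝ, E).prod 𝓘(ℝ, F).tangent) 𝓘(ℝ, F) ∞
      (fun u : M × TangentBundle 𝓘(ℝ, F) N => e u.1 (fibreScale P q₁ q₂ l 1 u.1 u.2.snd))
      (pullbackTangent F b) := by
    rintro u hu
    have hu' : u.2.proj = b u.1 := hu
    obtain ⟨h1, h2⟩ := hs.one_add_pos hpos u.1 u.2.snd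
    have h3 := hs.contMDiffWithinAt_fibreScale hl hu h1 h2
    obtain ⟨h4, h5⟩ := hmem u.1 u.2.snd
    have h6 := (h.local_right_inv _ h4).1
    simp only [h5] at h6
    rw [← hu'] at h6
    exact ContMDiffWithinAt.comp (g := fun u : M × TangentBundle 𝓘(ℝ, F) N => e u.1 u.2.snd)
      (f := fun u => (u.1, tangentMk u.2.proj (fibreScale P q₁ q₂ l 1 u.1 u.2.snd))) u h6
      (contMDiffWithinAt_fst.prodMk h3) fun u hu => hu
  have hzero : ∀ x, e x (fibreScale P q₁ q₂ l 1 x 0) = b x := fun x => by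
    have := h.left_inv _ (h.graph_mem x)
    rwa [h0, ← fibreScale_zero (P := P) (q₁ := q₁) (q₂ := q₂) (l := l) (ε := 1) x] at this
  refine ⟨?_, fun x w => ⟨(hmem x w).1, ?_⟩, hsmooth, ?_, ?_, ?_, hzero, ?_⟩
  · have h1 : ContinuousOn (fun p : M × N => (l p.1 * q₁ p.1 (ψ p.1 p.2),
        l p.1 * q₂ p.1 (ψ p.1 p.2))) W := by
      have hc : ContinuousOn (fun p : M × N => l p.1) W :=
        (hl.continuous.comp continuous_fst).continuousOn
      exact (hc.mul (hs.smooth_left.comp hWψ fun p _ => rfl).continuousOn).prodMk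
        (hc.mul (hs.smooth_right.comp hWψ fun p _ => rfl).continuousOn)
    exact h1.isOpen_inter_preimage h.isOpen ((isOpen_Iio (a := (1 : ℝ))).prod
      (isOpen_Iio (a := (1 : ℝ))))
  · simp only [(hmem x w).2]
    exact hs.fibreScale_mem_fibreDisc hpos x w
  · intro p hp
    have h3 := hs.contMDiffWithinAt_fibreScale hl (ε := -1)
      (u := (p.1, tangentMk (b p.1) (ψ p.1 p.2))) rfl
      (by have := hp.2.1; simp only at this ⊢; linarith)
      (by have := hp.2.2; simp only at this ⊢; linarith)
    exact ContMDiffWithinAt.comp p h3 ((hWψ p hp.1).mono inter_subset_left) fun p _ => rfl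
  · intro x w
    obtain ⟨h1, h2⟩ := hs.one_add_pos hpos x w
    simp only [(hmem x w).2]
    exact hs.fibreScale_fibreScale h1 h2
  · intro p hp
    have h1 := hs.fibreScale_fibreScale (l := l) (ε := -1) (x := p.1) (w := ψ p.1 p.2)
      (by have := hp.2.1; simp only at this ⊢; linarith)
      (by have := hp.2.2; simp only at this ⊢; linarith)
    rw [neg_neg] at h1
    simp only [h1]
    exact h.left_inv p hp.1
  · intro x w
    have hc : ContMDiff 𝓘(ℝ, ℝ) (𝓘(ℝ, E).prod 𝓘(ℝ, F).tangent) ∞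
        (fun t : ℝ => ((x, tangentMk (b x) (t • w)) : M × TangentBundle 𝓘(ℝ, F) N)) := fun t =>
      contMDiffAt_const.prodMk (ContMDiffWithinAt.tangentMk_smul (s := univ) contMDiffWithinAt_id
        contMDiffWithinAt_const)
    have hγ : MDifferentiableAt 𝓘(ℝ, ℝ) 𝓘(ℝ, F)
        (fun t : ℝ => e x (fibreScale P q₁ q₂ l 1 x (t • w))) 0 :=
      (contMDiffOn_univ.1 (hsmooth.comp hc.contMDiffOn (s := univ) fun t _ =>
        rfl)).mdifferentiableAt (by simp)
    refine hγ.hasMFDerivAt.congr_mfderiv ?_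
    have hγ0 : e x (fibreScale P q₁ q₂ l 1 x ((0 : ℝ) • w)) = b x := by rw [zero_smul, hzero]
    -- `ψ` composed with the curve is `fibreScale` along `t • w`, and `ψ` has derivative the
    -- identity at `b x`, so the curve has the same derivative as `fibreScale`.
    have hψ' : HasMFDerivAt 𝓘(ℝ, F) 𝓘(ℝ, F) (ψ x)
        (e x (fibreScale P q₁ q₂ l 1 x ((0 : ℝ) • w))) (ContinuousLinearMap.id ℝ F) := by
      rw [hγ0]; exact hψ x
    let L : ℝ →L[ℝ] F := mfderiv 𝓘(ℝ, ℝ) 𝓘(ℝ, F)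
      (fun t : ℝ => e x (fibreScale P q₁ q₂ l 1 x (t • w))) 0
    have h1 : HasMFDerivAt 𝓘(ℝ, ℝ) 𝓘(ℝ, F)
        (ψ x ∘ fun t : ℝ => e x (fibreScale P q₁ q₂ l 1 x (t • w))) 0 L :=
      HasMFDerivAt.comp (0 : ℝ) hψ' hγ.hasMFDerivAt
    have h2 : (ψ x ∘ fun t : ℝ => e x (fibreScale P q₁ q₂ l 1 x (t • w))) =
        fun t : ℝ => fibreScale P q₁ q₂ l 1 x (t • w) := by
      funext t
      exact (hmem x (t • w)).2
    rw [h2] at h1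
    have h3 : HasFDerivAt (fun t : ℝ => fibreScale P q₁ q₂ l 1 x (t • w)) L 0 := h1.hasFDerivAt
    exact h3.unique (hs.hasDerivAt_fibreScale x w).hasFDerivAt

end ExistsLinearization

/-! ### Splitting off `ker Tf`. -/

section ConstantRankSplitting

open Topology Filter

variable {E : Type*} [NormedAddCommGroup E] [NormedSpace ℝ E]
  {F : Type*} [NormedAddCommGroup F] [NormedSpace ℝ F]
  {M : Type*} [TopologicalSpace M] [ChartedSpace E M]
  {N : Type*} [TopologicalSpace N] [ChartedSpace F N]
  {ι : Type*} {ρ : SmoothPartitionOfUnity ι 𝓘(ℝ, E) M univ}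
  {f : M → N} {φ : ι → OpenPartialHomeomorph M E} {χ : ι → OpenPartialHomeomorph N F}
  {A : ι → E →L[ℝ] F} {B : ι → F →L[ℝ] E}

variable (ρ φ A B) in
/-- A projection of `T_x M` onto `ker T_x f`, built from linearizing charts of `f` and generalized
inverses `B i` of the linear maps `A i`. -/
noncomputable def kerProj (x : M) : E →L[ℝ] E :=
  patch ρ x fun i => (fibInv (φ i) x).comp
    ((ContinuousLinearMap.id ℝ E - (B i).comp (A i)).comp (fibCoord (φ i) x))

theorem kerProj_apply (x : M) (v : E) : kerProj ρ φ A B x v = patch ρ x fun i =>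
    fibInv (φ i) x ((ContinuousLinearMap.id ℝ E - (B i).comp (A i)) (fibCoord (φ i) x v)) :=
  map_patch (ContinuousLinearMap.apply ℝ E v).toLinearMap x _

/-- Every summand lies in the kernel because `A (id - B A) = 0`. -/
theorem fibDeriv_kerProj (hl : ∀ i, IsLinearizing f (φ i) (χ i) (A i))
    (hB : ∀ i v, A i (B i (A i v)) = A i v) (hs : ∀ i, tsupport (ρ i) ⊆ (φ i).source) {x : M}
    (hf : MDifferentiableAt 𝓘(ℝ, E) 𝓘(ℝ, F) f x) (v : E) :
    fibDeriv E F f x (kerProj ρ φ A B x v) = 0 := by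
  rw [kerProj_apply]
  refine (map_patch (fibDeriv E F f x).toLinearMap _ _).trans
    ((patch_congr fun i hi => ?_).trans (patch_const 0))
  have h1 := (hl i).fibCoord_fibDeriv (hs i hi) hf (fibInv (φ i) x
    ((ContinuousLinearMap.id ℝ E - (B i).comp (A i)) (fibCoord (φ i) x v)))
  rw [(hl i).left.fibCoord_fibInv (hs i hi)] at h1
  have h2 := (hl i).right.fibInv_fibCoord ((hl i).mapsTo (hs i hi)) (fibDeriv E F f x
    (fibInv (φ i) x ((ContinuousLinearMap.id ℝ E - (B i).comp (A i)) (fibCoord (φ i) x v))))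
  rw [h1] at h2
  refine h2.symm.trans ?_
  simp [hB]

/-- On the kernel the coordinate vector is annihilated by each contributing `A i`, so each summand
returns `v`. An average of projections onto a common subspace is again a projection onto it. -/
theorem kerProj_of_fibDeriv_eq_zero (hl : ∀ i, IsLinearizing f (φ i) (χ i) (A i))
    (hs : ∀ i, tsupport (ρ i) ⊆ (φ i).source) {x : M}
    (hf : MDifferentiableAt 𝓘(ℝ, E) 𝓘(ℝ, F) f x) {v : E} (hv : fibDeriv E F f x v = 0) :
    kerProj ρ φ A B x v = v := by
  rw [kerProj_apply]
  refine (patch_congr fun i hi => ?_).trans (patch_const v)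
  have h1 := (hl i).fibCoord_fibDeriv (hs i hi) hf v
  rw [hv, map_zero] at h1
  simp only [sub_apply, ContinuousLinearMap.id_apply,
    ContinuousLinearMap.comp_apply, ← h1, map_zero, sub_zero]
  exact (hl i).left.fibInv_fibCoord (hs i hi) v

theorem contMDiffOn_kerProj [IsManifold 𝓘(ℝ, E) ∞ M] (hφ : ∀ i, IsSmoothChart (φ i))
    (hs : ∀ i, tsupport (ρ i) ⊆ (φ i).source) :
    ContMDiffOn (𝓘(ℝ, E).prod 𝓘(ℝ, E).tangent) 𝓘(ℝ, E).tangent ∞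
      (fun u : M × TangentBundle 𝓘(ℝ, E) M =>
        tangentMk u.2.proj (kerProj ρ φ A B u.1 u.2.snd)) (pullbackTangent E id) := by
  intro u hu
  have hproj : ContMDiff (𝓘(ℝ, E).prod 𝓘(ℝ, E).tangent) 𝓘(ℝ, E) ∞
      (fun u : M × TangentBundle 𝓘(ℝ, E) M => u.2.proj) :=
    (Bundle.contMDiff_proj _).comp contMDiff_snd
  let vec : M × TangentBundle 𝓘(ℝ, E) M → E := fun u => u.2.snd
  have hu' : u.2.proj = u.1 := hu
  have h : ContMDiffWithinAt (𝓘(ℝ, E).prod 𝓘(ℝ, E).tangent) 𝓘(ℝ, E).tangent ∞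
      (fun u : M × TangentBundle 𝓘(ℝ, E) M =>
        tangentMk u.2.proj (patch ρ u.2.proj fun i => fibInv (φ i) u.2.proj
          ((ContinuousLinearMap.id ℝ E - (B i).comp (A i)) (fibCoord (φ i) u.2.proj (vec u)))))
      (pullbackTangent E id) u := by
    refine contMDiffWithinAt_tangentMk_patch hproj.contMDiffAt.contMDiffWithinAt
      hproj.contMDiffAt.contMDiffWithinAt fun i hi => ?_
    have hi' : u.2.proj ∈ (φ i).source := hs i hi
    have h1 : ContMDiffAt (𝓘(ℝ, E).prod 𝓘(ℝ, E).tangent) 𝓘(ℝ, E) ∞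
        (fun u : M × TangentBundle 𝓘(ℝ, E) M => fibCoord (φ i) u.2.proj u.2.snd) u :=
      ((hφ i).contMDiffOn_fibCoord.contMDiffAt
        (((φ i).open_source.preimage (FiberBundle.continuous_proj E _)).mem_nhds hi')).comp u
        contMDiffAt_snd
    have h2 := ((ContinuousLinearMap.id ℝ E - (B i).comp (A i)).contDiff
      (n := ∞)).contMDiff.contMDiffAt.comp_contMDiffWithinAt u
        (h1.contMDiffWithinAt (s := pullbackTangent E id))
    exact (hφ i).contMDiffWithinAt_fibInv hproj.contMDiffAt.contMDiffWithinAt h2 hi'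
  refine h.congr (fun u hu => ?_) ?_
  · have hu' : u.2.proj = u.1 := hu
    rw [← hu']
    exact congrArg (tangentMk u.2.proj) (kerProj_apply u.2.proj (vec u))
  · rw [← hu']
    exact congrArg (tangentMk u.2.proj) (kerProj_apply u.2.proj (vec u))

variable [IsManifold 𝓘(ℝ, F) ∞ N]

theorem contMDiffOn_fibDeriv [IsManifold 𝓘(ℝ, E) ∞ M] (hf : ContMDiff 𝓘(ℝ, E) 𝓘(ℝ, F) ∞ f) :
    ContMDiffOn (𝓘(ℝ, E).prod 𝓘(ℝ, E).tangent) 𝓘(ℝ, F).tangent ∞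
      (fun u : M × TangentBundle 𝓘(ℝ, E) M =>
        tangentMk (f u.1) (fibDeriv E F f u.1 u.2.snd)) (pullbackTangent E id) := by
  have h1 := ((hf.contMDiff_tangentMap (m := ∞) (by simp)).comp
    (contMDiff_snd (M := M) (I := 𝓘(ℝ, E)))).contMDiffOn (s := pullbackTangent E id)
  refine h1.congr fun u hu => ?_
  have hu' : u.2.proj = u.1 := hu
  rw [← hu']
  rfl

variable [FiniteDimensional ℝ F]

/-- The trivial splitting of `f^* TN`. -/
theorem fibreSplitting_trivial (hχ : ∀ i, IsSmoothChart (χ i)) (hs : ∀ i, tsupport (ρ i) ⊆ f ⁻¹' (χ i).source) :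
    FibreSplitting E f (fun _ => 0) (fibreSq ρ f χ) (fun _ _ => 0) where
  smooth_proj := by
    intro u hu
    have h : ContMDiffWithinAt (𝓘(ℝ, E).prod 𝓘(ℝ, F).tangent) 𝓘(ℝ, F).tangent ∞
        (fun u : M × TangentBundle 𝓘(ℝ, F) N => tangentMk u.2.proj u.2.snd)
        (pullbackTangent F f) u := contMDiffWithinAt_snd
    have h2 := ContMDiffWithinAt.tangentMk_smul (r := fun _ => (0 : ℝ)) contMDiffWithinAt_const h
    exact h2.congr (fun u _ => congrArg (tangentMk u.2.proj) (zero_smul ℝ (_ : F)).symm)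
      (congrArg (tangentMk u.2.proj) (zero_smul ℝ (_ : F)).symm)
  smooth_left := by
    intro u hu
    refine contMDiffWithinAt_fibreSq hχ hs contMDiffWithinAt_fst ?_
    refine (contMDiffWithinAt_snd (I := 𝓘(ℝ, E)) (J := 𝓘(ℝ, F).tangent)
      (s := pullbackTangent F f)).congr (fun u hu => ?_) ?_
    · have hu' : u.2.proj = f u.1 := hu
      rw [← hu']
    · have hu' : u.2.proj = f u.1 := hu
      rw [← hu']
  smooth_right := contMDiffOn_const
  proj_proj := by simp
  nonneg_left := fibreSq_nonneg
  nonneg_right := fun _ _ => le_rfl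
  left_smul := fun x s t w => by simp [fibreSq_smul]
  right_smul := fun x s t w => by simp

variable [FiniteDimensional ℝ E]

/-- The splitting of `TM` into `ker Tf` and a complement, for `f` of constant rank. -/
theorem fibreSplitting_kerProj [IsManifold 𝓘(ℝ, E) ∞ M] (hf : ContMDiff 𝓘(ℝ, E) 𝓘(ℝ, F) ∞ f)
    (hl : ∀ i, IsLinearizing f (φ i) (χ i) (A i)) (hB : ∀ i v, A i (B i (A i v)) = A i v)
    (hs : ∀ i, tsupport (ρ i) ⊆ (φ i).source) :
    FibreSplitting E id (kerProj ρ φ A B) (fun x v => fibreSq ρ f χ x (fibDeriv E F f x v))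
      (fun x v => fibreSq ρ id φ x (kerProj ρ φ A B x v)) := by
  have hfd : ∀ x, MDifferentiableAt 𝓘(ℝ, E) 𝓘(ℝ, F) f x := fun x => hf.mdifferentiableAt (by simp)
  have hDP : ∀ x v, fibDeriv E F f x (kerProj ρ φ A B x v) = 0 := fun x v =>
    fibDeriv_kerProj hl hB hs (hfd x) v
  have hPP : ∀ x v, kerProj ρ φ A B x (kerProj ρ φ A B x v) = kerProj ρ φ A B x v := fun x v =>
    kerProj_of_fibDeriv_eq_zero hl hs (hfd x) (hDP x v)
  have hP := contMDiffOn_kerProj (A := A) (B := B) (fun i => (hl i).left) hs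
  refine ⟨hP, fun u hu => ?_, fun u hu => ?_, hPP, fun _ _ => fibreSq_nonneg _ _,
    fun _ _ => fibreSq_nonneg _ _, fun x s t v => ?_, fun x s t v => ?_⟩
  · exact contMDiffWithinAt_fibreSq (fun i => (hl i).right)
      (fun i => (hs i).trans (hl i).mapsTo) contMDiffWithinAt_fst (contMDiffOn_fibDeriv hf u hu)
  · refine contMDiffWithinAt_fibreSq (fun i => (hl i).left) hs contMDiffWithinAt_fst ?_
    refine (hP u hu).congr (fun u hu => ?_) ?_
    · have hu' : u.2.proj = u.1 := hu
      simp only [hu']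
    · have hu' : u.2.proj = u.1 := hu
      simp only [hu']
  · simp only [map_add, map_smul, map_sub, hDP, sub_zero, smul_zero, add_zero, fibreSq_smul]
  · simp only [map_add, map_smul, map_sub, hPP, sub_self, smul_zero, zero_add, fibreSq_smul]

end ConstantRankSplitting

/-! ### Linearizations intertwined by `f`. -/

section CompatibleLinearizations

open Topology Filter

variable {E : Type*} [NormedAddCommGroup E] [NormedSpace ℝ E]
  {F : Type*} [NormedAddCommGroup F] [NormedSpace ℝ F]
  {M : Type*} [TopologicalSpace M] [ChartedSpace E M] [IsManifold 𝓘(ℝ, E) ∞ M]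
  {N : Type*} [TopologicalSpace N] [ChartedSpace F N] [IsManifold 𝓘(ℝ, F) ∞ N]

/-- For `f` of constant rank there are linearizations along `id` and along `f` that intertwine
`Tf` and `f`. -/
theorem IsRegularMap.exists_compatible_linearizations [FiniteDimensional ℝ E]
    [FiniteDimensional ℝ F] [T2Space M] [ParacompactSpace M] {f : M → N}
    (hf : IsRegularMap E F f) :
    ∃ (VM : Set (M × M)) (νM : M → E → M) (ΛM : M → M → E) (VN : Set (M × N)) (νN : M → F → N)
      (ΛN : M → N → F), FibreLinearization E id VM νM ΛM ∧ FibreLinearization E f VN νN ΛN ∧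
      ∀ x v, f (νM x v) = νN x (fibDeriv E F f x v) := by
  have : CompleteSpace E := FiniteDimensional.complete ℝ E
  have : CompleteSpace F := FiniteDimensional.complete ℝ F
  have hfs : ContMDiff 𝓘(ℝ, E) 𝓘(ℝ, F) ∞ f := hf.1
  have hfd : ∀ x, MDifferentiableAt 𝓘(ℝ, E) 𝓘(ℝ, F) f x := fun x => hfs.mdifferentiableAt (by simp)
  choose φ χ A hx hl using fun x₀ => hf.exists_isLinearizing x₀
  choose B hB using fun x₀ => exists_generalized_inverse (A x₀)
  obtain ⟨ρ, hs⟩ := exists_smoothPartitionOfUnity (E := E) (fun x₀ => (φ x₀).source)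
    fun x₀ => (φ x₀).open_source.mem_nhds (hx x₀)
  have hφ := fun i => (hl i).left
  have hχ := fun i => (hl i).right
  have hs' : ∀ i, tsupport (ρ i) ⊆ f ⁻¹' (χ i).source := fun i => (hs i).trans (hl i).mapsTo
  obtain ⟨WN, eN, hN, -⟩ := exists_fibrewise_inverse hfs.continuous (P := fun _ => True)
    (eventually_contMDiffAt_tangentLog hχ hfs hs') (hasMFDerivAt_tangentLog hχ hs')
    fun _ => Eventually.of_forall fun _ => trivial
  -- These conditions cut down `WM` so that `id × f` maps it into `WN` and the two logarithms
  -- correspond on it.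
  have hcompat : ∀ x₀ : M, ∀ᶠ p : M × M in 𝓝 (x₀, id x₀), (p.1, f p.2) ∈ WN ∧
      fibDeriv E F f p.1 (tangentLog ρ id φ p.1 p.2) = tangentLog ρ f χ p.1 (f p.2) := by
    intro x₀
    have hc : Continuous fun p : M × M => (p.1, f p.2) :=
      continuous_fst.prodMk (hfs.continuous.comp continuous_snd)
    have h1 : ∀ᶠ p : M × M in 𝓝 (x₀, id x₀), (p.1, f p.2) ∈ WN :=
      hc.continuousAt.eventually (hN.isOpen.mem_nhds (hN.graph_mem x₀))
    have h2 : ∀ᶠ x in 𝓝 x₀, ∀ i, x ∈ tsupport (ρ i) → x ∈ (φ i).source ∧ i ∈ ρ.fintsupport x₀ := by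
      filter_upwards [ρ.eventually_fintsupport_subset x₀] with x hx i hi
      exact ⟨hs i hi, hx ((ρ.mem_fintsupport_iff x i).2 hi)⟩
    have h3 : ∀ᶠ y in 𝓝 x₀, ∀ i ∈ ρ.fintsupport x₀, y ∈ (φ i).source :=
      (Filter.eventually_all_finset _).2 fun i hi =>
        (φ i).open_source.mem_nhds (hs i ((ρ.mem_fintsupport_iff x₀ i).1 hi))
    filter_upwards [h1, (continuousAt_fst (p := (x₀, id x₀))).eventually h2,
      (continuousAt_snd (p := (x₀, id x₀))).eventually h3] with p hp1 hp2 hp3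
    exact ⟨hp1, fibDeriv_tangentLog hl (hfd p.1) fun i hi =>
      ⟨(hp2 i hi).1, hp3 i (hp2 i hi).2⟩⟩
  obtain ⟨WM, eM, hM, hMP⟩ := exists_fibrewise_inverse (E := E) (F := E) (b := (id : M → M))
    continuous_id (eventually_contMDiffAt_tangentLog hφ contMDiff_id hs)
    (hasMFDerivAt_tangentLog hφ hs) hcompat
  -- The left quadratic function on `TM` is the pullback under `Tf` of the one on `f^*TN`, so `v - P
  -- v` and `Tf v` are scaled by the same factor.
  have hsN := fibreSplitting_trivial (E := E) hχ hs'
  have hsM := fibreSplitting_kerProj hfs hl hB hs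
  have hN0 : ∀ x, tangentLog ρ f χ x (f x) = 0 := tangentLog_self
  have hM0 : ∀ x, tangentLog ρ id φ x (id x) = 0 := tangentLog_self
  obtain ⟨lN, hlN, hlNpos, hlND⟩ := exists_contMDiff_control hfs hsN.smooth_left
    (fun x t w => fibreSq_smul x t w) (fun x w => fibreSq_nonneg x w)
    (fun x w => fibreSq_eq_zero hχ hs') (hN.mem_nhdsWithin_zero hN0)
  obtain ⟨lM, hlM, hlMpos, hlMD⟩ := exists_contMDiff_control (b := (id : M → M)) contMDiff_id
    (hsM.smooth_left.add hsM.smooth_right)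
    (fun x t w => by simp only [map_smul, fibreSq_smul]; ring)
    (fun x w => add_nonneg (hsM.nonneg_left x w) (hsM.nonneg_right x w))
    (fun x w h => by
      have h1 := (add_eq_zero_iff_of_nonneg (hsM.nonneg_left x w) (hsM.nonneg_right x w)).1 h
      have h2 := fibreSq_eq_zero hχ hs' h1.1
      have h3 := fibreSq_eq_zero hφ hs h1.2
      rw [← h3, kerProj_of_fibDeriv_eq_zero hl hs (hfd x) h2])
    (hM.mem_nhdsWithin_zero hM0)
  -- Compatibility requires one `l` for both bundles. The factor `2` is needed on `M`: `l q₁ < 1`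
  -- and `l q₂ < 1` must imply `lM (q₁ + q₂) < 1`.
  let l : M → ℝ := fun x => 2 * lM x + lN x
  have hlsm : ContMDiff 𝓘(ℝ, E) 𝓘(ℝ, ℝ) ∞ l := (contMDiff_const.mul hlM).add hlN
  have hlpos : ∀ x, 0 < l x := fun x => by
    have := hlMpos x
    have := hlNpos x
    simp only [l]
    linarith
  have hdN : ∀ x w, (x, w) ∈ fibreDisc (fibreSq ρ f χ) (fun _ _ => 0) l →
      (x, eN x w) ∈ WN ∧ tangentLog ρ f χ x (eN x w) = w := by
    intro x w h
    refine hlND x w (lt_of_le_of_lt ?_ h.1)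
    exact mul_le_mul_of_nonneg_right (by have := hlMpos x; simp only [l]; linarith)
      (fibreSq_nonneg x w)
  have hdM : ∀ x v, (x, v) ∈ fibreDisc (fun x v => fibreSq ρ f χ x (fibDeriv E F f x v))
      (fun x v => fibreSq ρ id φ x (kerProj ρ φ A B x v)) l →
      (x, eM x v) ∈ WM ∧ tangentLog ρ id φ x (eM x v) = v := by
    rintro x v ⟨h1, h2⟩
    refine hlMD x v ?_
    simp only [l] at h1 h2
    have h3 := mul_nonneg (hlNpos x).le (hsM.nonneg_left x v)
    have h4 := mul_nonneg (hlNpos x).le (hsM.nonneg_right x v)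
    rw [mul_add]
    linarith
  have hLN := hN.fibreLinearization hN0 (hasMFDerivAt_tangentLog hχ hs') hsN hlsm hlpos hdN
  have hLM := hM.fibreLinearization hM0 (hasMFDerivAt_tangentLog hφ hs) hsM hlsm hlpos hdM
  refine ⟨_, _, _, _, _, _, hLM, hLN, fun x v => ?_⟩
  -- For `y = νM x v` the logarithm of `f y` is `Tf` of the rescaled `v`, and `eN` recovers `f y`
  -- from it. `Tf` kills the kernel component, which leaves the rescaled `Tf v`.
  obtain ⟨h1, h2⟩ := hdM x _ (hsM.fibreScale_mem_fibreDisc hlpos x v)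
  obtain ⟨h3, h4⟩ := hMP _ h1
  simp only at h3 h4
  rw [h2] at h4
  have h5 := hN.left_inv _ h3
  simp only at h5
  rw [← h5, ← h4]
  congr 1
  simp only [fibreScale, map_add, map_smul, map_sub, fibDeriv_kerProj hl hB hs (hfd x), sub_zero,
    smul_zero, add_zero, zero_apply]

namespace FibreLinearization

variable {V : Set (M × M)} {ν : M → E → M} {Λ : M → M → E}

/-- Replaces `id^* TM` by `TM` and allows restriction to a subset, so that it serves both `TM` and
`ker Tf`. -/
theorem isDiffeoOn_tangentBundle (h : FibreLinearization E id V ν Λ)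
    {D : Set (TangentBundle 𝓘(ℝ, E) M)} {Y : Set (M × M)}
    (hD : ∀ x v, tangentMk x v ∈ D ↔ (x, ν x v) ∈ Y) :
    IsDiffeoOn 𝓘(ℝ, E).tangent (𝓘(ℝ, E).prod 𝓘(ℝ, E))
      (fun v : TangentBundle 𝓘(ℝ, E) M => (v.proj, ν v.proj v.snd)) D (Y ∩ V) := by
  have h1 : ContMDiff 𝓘(ℝ, E).tangent 𝓘(ℝ, E) ∞
      (fun v : TangentBundle 𝓘(ℝ, E) M => v.proj) := Bundle.contMDiff_proj _
  refine ⟨fun v hv => ⟨(hD v.proj v.snd).1 hv, h.mem _ _⟩, ?_,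
    fun p => tangentMk p.1 (Λ p.1 p.2), fun p hp => ?_, h.smooth_inv.mono inter_subset_right,
    fun v _ => ?_, fun p hp => ?_⟩
  · exact (h1.prodMk (contMDiffOn_univ.1 (h.smooth.comp (h1.prodMk contMDiff_id).contMDiffOn
      (s := univ) fun _ _ => rfl))).contMDiffOn
  · rw [hD, h.right_inv p hp.2]
    exact hp.1
  · exact congrArg (tangentMk v.proj) (h.left_inv v.proj v.snd)
  · exact Prod.ext rfl (h.right_inv p hp.2)

end FibreLinearization

end CompatibleLinearizations

/-! ### The theorem. -/

theorem theorem5p1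
    {E : Type*} [NormedAddCommGroup E] [NormedSpace ℝ E] [FiniteDimensional ℝ E]
    {F : Type*} [NormedAddCommGroup F] [NormedSpace ℝ F] [FiniteDimensional ℝ F]
    {M : Type*} [TopologicalSpace M] [T2Space M] [ParacompactSpace M]
    [ChartedSpace E M] [IsManifold 𝓘(ℝ, E) ∞ M]
    {N : Type*} [TopologicalSpace N] [T2Space N] [ParacompactSpace N]
    [ChartedSpace F N] [IsManifold 𝓘(ℝ, F) ∞ N]
    (f : M → N) (hf : IsRegularMap E F f) :
    ∃ (SK : SmoothLocalDeflation (𝓘(ℝ, E).prod 𝓘(ℝ, E)) (diagonal M) (levelPairs f))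
      (SM : SmoothLocalDeflation (𝓘(ℝ, E).prod 𝓘(ℝ, E)) (diagonal M) (univ : Set (M × M)))
      (SN : SmoothLocalDeflation (𝓘(ℝ, E).prod 𝓘(ℝ, F)) (graphSet f) (univ : Set (M × N))),
      -- the three deflations are kinematic, with the first projection as retraction
      SK.IsKinematic ∧ SM.IsKinematic ∧ SN.IsKinematic ∧
      (∀ p ∈ SK.V, SK.τ p = (p.1, p.1)) ∧
      (∀ p ∈ SM.V, SM.τ p = (p.1, p.1)) ∧
      (∀ p ∈ SN.V, SN.τ p = (p.1, f p.1)) ∧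
      ∃ (νK : TangentBundle 𝓘(ℝ, E) M → M × M) (νM : TangentBundle 𝓘(ℝ, E) M → M × M)
        (νN : M × TangentBundle 𝓘(ℝ, F) N → M × N),
        -- the vertical maps are diffeomorphisms of `ker Tf`, `TM` and `f^*TN` onto neighbourhoods
        IsDiffeoOn 𝓘(ℝ, E).tangent (𝓘(ℝ, E).prod 𝓘(ℝ, E)) νK (kerTangentMap E F f) SK.V ∧
        IsDiffeoOn 𝓘(ℝ, E).tangent (𝓘(ℝ, E).prod 𝓘(ℝ, E)) νM univ SM.V ∧
        IsDiffeoOn (𝓘(ℝ, E).prod 𝓘(ℝ, F).tangent) (𝓘(ℝ, E).prod 𝓘(ℝ, F)) νN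
          (pullbackTangent F f) SN.V ∧
        -- they are the inverses of the kinematic maps
        (∀ v ∈ kerTangentMap E F f, SK.kinematicMap (νK v) = verticalLift v.proj v) ∧
        (∀ v, SM.kinematicMap (νM v) = verticalLift v.proj v) ∧
        (∀ p ∈ pullbackTangent F f, SN.kinematicMap (νN p) = verticalLift p.1 p.2) ∧
        -- the two squares commute
        (∀ v ∈ kerTangentMap E F f, νM v = νK v) ∧
        (∀ v, νN (v.proj, tangentMap 𝓘(ℝ, E) 𝓘(ℝ, F) f v) = ((νM v).1, f (νM v).2)) := by
  obtain ⟨VM, νM, ΛM, VN, νN, ΛN, hM, hN, hcompat⟩ := hf.exists_compatible_linearizations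
  have hfs : ContMDiff 𝓘(ℝ, E) 𝓘(ℝ, F) ∞ f := hf.1
  have hid : ContMDiff 𝓘(ℝ, E) 𝓘(ℝ, E) ∞ (id : M → M) := contMDiff_id
  -- `f (νM x v) = νN x (Tf v)` and `f x = νN x 0`; injectivity of `νN x` compares them.
  have hker : ∀ x v, (x, νM x v) ∈ levelPairs f ↔ fibDeriv E F f x v = 0 := by
    intro x v
    change f x = f (νM x v) ↔ _
    rw [hcompat]
    constructor
    · intro h
      have h1 := hN.left_inv x (fibDeriv E F f x v)
      rw [← h, ← hN.zero x, hN.left_inv] at h1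
      exact h1.symm
    · intro h
      rw [h, hN.zero]
  have hdiag : ∀ p : M × M, p ∈ diagonal M ↔ p.2 = id p.1 := fun p => eq_comm
  have hgraph : ∀ p : M × N, p ∈ graphSet f ↔ p.2 = f p.1 := fun p => Iff.rfl
  have hsub : diagonal M ⊆ levelPairs f := fun p hp => congrArg f hp
  have hYK : ∀ p ∈ levelPairs f ∩ VM, ∀ t : ℝ,
      (p.1, νM p.1 (t • ΛM p.1 p.2)) ∈ levelPairs f := by
    rintro p ⟨hp, hpV⟩ t
    have h1 := (hker p.1 (ΛM p.1 p.2)).1 (by rw [hM.right_inv p hpV]; exact hp)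
    rw [hker, map_smul, h1, smul_zero]
  -- The deflation of `K_f` is the restriction of the one on `M × M`, so `νK` and `νM` have the same
  -- formula.
  refine ⟨hM.deflation hid hdiag hsub hYK,
    hM.deflation hid hdiag (subset_univ _) fun _ _ _ => mem_univ _,
    hN.deflation hfs hgraph (subset_univ _) fun _ _ _ => mem_univ _,
    hM.deflation_isKinematic hid hdiag hsub hYK ?_,
    hM.deflation_isKinematic hid hdiag _ _ fun _ _ _ _ _ _ => mem_univ _,
    hN.deflation_isKinematic hfs hgraph _ _ fun _ _ _ _ _ _ => mem_univ _,
    fun _ _ => rfl, fun _ _ => rfl, fun _ _ => rfl,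
    fun v => (v.proj, νM v.proj v.snd), fun v => (v.proj, νM v.proj v.snd),
    fun u => (u.1, νN u.1 u.2.snd), ?_, ?_, ?_, ?_, ?_, ?_, fun _ _ => rfl, fun v => ?_⟩
  · intro γ w hγ h0 h1 h2
    rw [hker]
    have hd1 : HasMFDerivAt 𝓘(ℝ, E) 𝓘(ℝ, F) f (γ 0).1 (fibDeriv (M := M) E F f (γ 0).1) :=
      (hfs.mdifferentiableAt (by simp)).hasMFDerivAt
    have hd2 : HasMFDerivAt 𝓘(ℝ, E) 𝓘(ℝ, F) f (γ 0).2 (fibDeriv (M := M) E F f (γ 0).2) :=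
      (hfs.mdifferentiableAt (by simp)).hasMFDerivAt
    have h3 := HasMFDerivAt.comp (0 : ℝ) hd1 h1
    have h4 := HasMFDerivAt.comp (0 : ℝ) hd2 h2
    have h5 : (f ∘ fun t => (γ t).1) = f ∘ fun t => (γ t).2 := funext fun t => hγ t
    have h6 : mfderiv 𝓘(ℝ, ℝ) 𝓘(ℝ, F) (f ∘ fun t => (γ t).1) 0 (1 : ℝ) = (0 : F) := by
      rw [h3.mfderiv]
      change fibDeriv E F f (γ 0).1 ((1 : ℝ) • 0) = 0
      rw [smul_zero, map_zero]
    have h7 : mfderiv 𝓘(ℝ, ℝ) 𝓘(ℝ, F) (f ∘ fun t => (γ t).2) 0 (1 : ℝ) =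
        fibDeriv E F f (γ 0).2 w := by
      rw [h4.mfderiv]
      change fibDeriv E F f (γ 0).2 ((1 : ℝ) • w) = _
      rw [one_smul]
    have h8 : (γ 0).2 = (γ 0).1 := h0
    rw [h5, h7, h8] at h6
    exact h6
  · exact hM.isDiffeoOn_tangentBundle fun x v => (hker x v).symm
  · exact hM.isDiffeoOn_tangentBundle fun x v => Iff.rfl
  · have h1 := hN.isDiffeoOn
    rwa [← univ_inter VN] at h1
  · exact fun v _ => hM.kinematicMap_deflation_apply hid hdiag hsub hYK v.proj v.snd
  · exact fun v => hM.kinematicMap_deflation_apply hid hdiag _ _ v.proj v.snd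
  · rintro ⟨x, ⟨y, w⟩⟩ hu
    have hy : y = f x := hu
    subst hy
    exact hN.kinematicMap_deflation_apply hfs hgraph _ _ x w
  · exact Prod.ext rfl (hcompat v.proj v.snd).symm
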